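/- For a normalized monotone set function $f:2^{[m]}\to\mathbb R$ write $f(S\mid T)=f(S\cup T)-f(T)$. A set $T\subseteq[m]$ is superadditive w.r.t. $f$ if there is $S\subseteq[m]\setminus T$ with $f(S\mid T)>f(S\mid T')$ for all $T'\subsetneq T$. The superadditive width of $f$ is the maximum cardinality of a superadditive set, and $f$ is in SAW-$d$ (where $0\le d\le m-1$) if its superadditive width is at most $d$. An instance consists of items $[m]$ and agents $1,\dots,n$ with valuations $f_1,\dots,f_n:2^{[m]}\to\mathbb R_{\ge0}$. In the Single-bid Auction each agent submits one bid, and in descending order of bids the agents buy any set of the available items, paying their bid for each item (a strategy is a bid in $\mathbb R_{\ge 0}$ and a plan which subset to buy from each possible set of available items). In the Simultaneous Item First Price Auction (SIA) each agent submits a bid in $\mathbb R_{\ge0}$ for every item, and each item goes to its highest bidder, who pays that bid. Ties are broken by a fixed priority order of the agents. Utilities are value minus payment. A coarse correlated equilibrium is a probability law on action profiles under which no agent gains in expectation by switching to a fixed action; mixed (pure) Nash equilibria are those whose law is a product measure (a point mass). The Price of Anarchy (Price of Stability) is the optimum social welfare divided by the smallest (largest) expected social welfare of an equilibrium, taken as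 a supremum (infimum) of ratios over equilibria. 1. For every integer $d\ge1$ and every $\varepsilon>0$ there is an instance with all valuations in SAW-$d$ such that, for every priority order, the Single-bid Auction has a pure Nash equilibrium and its Price of Stability is at least $d+1-\varepsilon/d$, with respect to pure Nash, mixed Nash, and coarse correlated equilibria. 2. For every integer $d\ge1$ there is an instance with all valuations in SAW-$d$ such that, for every priority order, the Price of Anarchy of SIA with respect to coarse correlated equilibria is at least $d+\frac1{d+1}$. -/

import Mathlib

open MeasureTheory
open scoped ENNReal NNReal

noncomputable section

/-! ### Superadditive width of set functions on the ground set `Fin m` -/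

/-- The margin `f(S | T) = f(S ∪ T) - f(T)`. -/
def margin {m : ℕ} (f : Finset (Fin m) → ℝ) (S T : Finset (Fin m)) : ℝ :=
  f (S ∪ T) - f T

/-- `T` is superadditive w.r.t. `f`: some `S` disjoint from `T` has a strictly larger margin
given `T` than given any proper subset of `T`. -/
def IsSuperadditiveSet {m : ℕ} (f : Finset (Fin m) → ℝ) (T : Finset (Fin m)) : Prop :=
  ∃ S : Finset (Fin m), Disjoint S T ∧ ∀ T' : Finset (Fin m), T' ⊂ T → margin f S T' < margin f S T

open Classical in
/-- The superadditive width: the largest cardinality of a superadditive set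
(`0` for a subadditive function). -/
def superadditiveWidth {m : ℕ} (f : Finset (Fin m) → ℝ) : ℕ :=
  (Finset.univ.filter (fun T : Finset (Fin m) => IsSuperadditiveSet f T)).sup Finset.card

/-- The `d`-th level of the superadditive width hierarchy of normalized monotone set functions. -/
def InSAW {m : ℕ} (d : ℕ) (f : Finset (Fin m) → ℝ) : Prop :=
  f ∅ = 0 ∧ Monotone f ∧ superadditiveWidth f ≤ d

/-! ### Auctions of the items `Fin m` among the agents `Fin n`, as simultaneous-move games -/

/-- An auction: the actions of an agent, and what each agent gets and pays
under each action profile. -/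
structure Auction (n m : ℕ) where
  Action : Type
  measAction : MeasurableSpace Action
  alloc : (Fin n → Action) → Fin n → Finset (Fin m)
  pay : (Fin n → Action) → Fin n → ℝ≥0

attribute [instance] Auction.measAction

/-- With bids `b` and ties broken by the priority order `π` (a smaller value is served first),
agent `j` comes before agent `i`. -/
def Precedes {n : ℕ} (π : Equiv.Perm (Fin n)) (b : Fin n → ℝ≥0) (j i : Fin n) : Prop :=
  b i < b j ∨ (b j = b i ∧ π j < π i)

/-- What an agent of the Single-bid Auction buys on their turn, for each set `R` of items that
may still be available: any subset of `R`. -/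
def PurchasePlan (m : ℕ) : Type :=
  {r : Finset (Fin m) → Finset (Fin m) // ∀ R, r R ⊆ R}

instance (m : ℕ) : MeasurableSpace (PurchasePlan m) := ⊤

open Classical in
/-- The number of agents that are served before agent `i`. -/
def turn {n : ℕ} (π : Equiv.Perm (Fin n)) (b : Fin n → ℝ≥0) (i : Fin n) : ℕ :=
  (Finset.univ.filter (fun j => Precedes π b j i)).card

/-- The set of items that each agent has bought after the first `t` agents were served, each of
them buying from what the earlier ones left. -/
def purchases {n m : ℕ} (π : Equiv.Perm (Fin n)) (b : Fin n → ℝ≥0)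
    (r : Fin n → PurchasePlan m) : ℕ → Fin n → Finset (Fin m)
  | 0 => fun _ => ∅
  | t + 1 => fun i =>
      if turn π b i = t then
        (r i).1 (Finset.univ \ Finset.univ.biUnion (purchases π b r t))
      else purchases π b r t i

/-- The Single-bid Auction: each agent submits one bid; in descending order of bids the agents
buy any set of the available items, paying their bid for each item. -/
def singleBidAuction {n : ℕ} (m : ℕ) (π : Equiv.Perm (Fin n)) : Auction n m where
  Action := ℝ≥0 × PurchasePlan m
  measAction := inferInstance
  alloc a := purchases π (fun i => (a i).1) (fun i => (a i).2) n
  pay a i := (a i).1 *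
    ((purchases π (fun j => (a j).1) (fun j => (a j).2) n i).card : ℝ≥0)

open Classical in
/-- The items for which agent `i` is the highest bidder. -/
def itemsWon {n m : ℕ} (π : Equiv.Perm (Fin n)) (a : Fin n → Fin m → ℝ≥0) (i : Fin n) :
    Finset (Fin m) :=
  Finset.univ.filter (fun x => ∀ j, j ≠ i → Precedes π (fun l => a l x) i j)

/-- The Simultaneous Item First Price Auction: each agent bids on every item; each item goes to
its highest bidder, who pays their bid for it. -/
def simultaneousItemAuction {n : ℕ} (m : ℕ) (π : Equiv.Perm (Fin n)) : Auction n m where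
  Action := Fin m → ℝ≥0
  measAction := inferInstance
  alloc a i := itemsWon π a i
  pay a i := ∑ x ∈ itemsWon π a i, a i x

/-! ### Equilibria, welfare, price of anarchy and price of stability -/

/-- A valuation profile. -/
abbrev Valuations (n m : ℕ) : Type := Fin n → Finset (Fin m) → ℝ

/-- The optimum social welfare. -/
def optWelfare {n m : ℕ} (v : Valuations n m) : ℝ≥0∞ :=
  ⨆ A ∈ {A : Fin n → Finset (Fin m) | Pairwise (fun i j => Disjoint (A i) (A j))},
    ∑ i, ENNReal.ofReal (v i (A i))

/-- The expected social welfare when the action profile has law `μ`. -/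
def expectedWelfare {n m : ℕ} (M : Auction n m) (v : Valuations n m)
    (μ : Measure (Fin n → M.Action)) : ℝ≥0∞ :=
  ∫⁻ a, ∑ i, ENNReal.ofReal (v i (M.alloc a i)) ∂μ

/-- The expected utility (value minus payment, possibly `-∞`) of agent `i` when `a` has law `μ`
and the profile `φ a` is played. -/
def expectedUtility {n m : ℕ} (M : Auction n m) (v : Valuations n m) (i : Fin n)
    (μ : Measure (Fin n → M.Action)) (φ : (Fin n → M.Action) → (Fin n → M.Action)) : EReal :=
  ((∫⁻ a, ENNReal.ofReal (v i (M.alloc (φ a) i)) ∂μ : ℝ≥0∞) : EReal)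
    - ((∫⁻ a, (M.pay (φ a) i : ℝ≥0∞) ∂μ : ℝ≥0∞) : EReal)

/-- Coarse correlated equilibria: laws of action profiles under which no agent gains by
switching to a fixed action. -/
def coarseCorrelated {n m : ℕ} (M : Auction n m) (v : Valuations n m) :
    Set (Measure (Fin n → M.Action)) :=
  {μ | IsProbabilityMeasure μ ∧ ∀ (i : Fin n) (a' : M.Action),
    expectedUtility M v i μ (fun a => Function.update a i a') ≤ expectedUtility M v i μ id}

/-- Mixed Nash equilibria: the agents randomize independently. -/
def mixedNash {n m : ℕ} (M : Auction n m) (v : Valuations n m) :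
    Set (Measure (Fin n → M.Action)) :=
  {μ | μ ∈ coarseCorrelated M v ∧
    ∃ σ : Fin n → Measure M.Action, (∀ i, IsProbabilityMeasure (σ i)) ∧ μ = Measure.pi σ}

/-- Pure Nash equilibria, as point masses. -/
def pureNash {n m : ℕ} (M : Auction n m) (v : Valuations n m) :
    Set (Measure (Fin n → M.Action)) :=
  {μ | μ ∈ coarseCorrelated M v ∧ ∃ a : Fin n → M.Action, μ = Measure.dirac a}

/-- The price of anarchy over a set `E` of equilibria: optimum welfare over worst equilibrium
welfare. -/
def priceOfAnarchy {n m : ℕ} (M : Auction n m) (v : Valuations n m)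
    (E : Set (Measure (Fin n → M.Action))) : ℝ≥0∞ :=
  ⨆ μ ∈ E, optWelfare v / expectedWelfare M v μ

/-- The price of stability over a set `E` of equilibria: optimum welfare over best equilibrium
welfare (meaningful for nonempty `E`). -/
def priceOfStability {n m : ℕ} (M : Auction n m) (v : Valuations n m)
    (E : Set (Measure (Fin n → M.Action))) : ℝ≥0∞ :=
  ⨅ μ ∈ E, optWelfare v / expectedWelfare M v μ

end

/-! All agents are single-minded: whoever wants one bundle of at most `d + 1` items lies in SAW-`d`
(`inSAW_singleMinded`).

Single-bid Auction. One agent wants all `d + 1` items, worth `d + 1`; many rivals want one common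
item, worth slightly more than 1. The bundle agent pays a single bid on every item. Winning
everything at a bid of at least `1 + g` loses money; winning it at a lower bid leaves each rival a
deviation that nets `g`. The rivals share one item, so their utilities have a bounded sum, and with
many rivals the low-bid event is rare (`lintegral_bundle_low_le`). The bundle agent does not lose on
average, so the high-bid event is rare too (`lintegral_bundle_high_le`). Every coarse correlated
equilibrium thus has welfare near 1, against an optimum of at least `d + 1`.

SIA. Nature draws a price vector from a finite set. Each positive price is bid by two competitors,
so that every deviator faces these prices. Row agents want disjoint bundles worth 1, which make up
the optimum, but each row always contains a priced item, so in equilibrium they get nothing. Welfare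
comes only from the active bundles, worth `w` each. If no fixed bid vector profits against the
prices (`NoGain`) and the active bundles are affordable on average, then the number of rows divided
by the value of the active bundles bounds the Price of Anarchy
(`PriceScheme.exists_le_priceOfAnarchy`).

For `k = d + 1 ≥ 3` the items are the unordered pairs of `k` points, diagonal ones included. A
random point prices its star. The rows are the `k` sets of pairs with a given sum, each meeting each
star in one item. Prices have the form `t / (c + t)` with `t` nearly uniform and `c` the odds that a
pair misses the random point: what a bid gains when its item is priced is then offset by what it
pays when the item is free. Stars may be worth `w = k ^ 2 / (k ^ 2 - k + 1)`, and `k / w = k - 1 + 1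
/ k`. For `d = 1`, two triangles with prices 0 and `1 / 2` give `3 / 2`. -/

/-! ### Single-minded valuations and their superadditive width -/

/-- The valuation of an agent who wants all of `S`, worth `V`, and nothing else. -/
noncomputable def singleMinded {m : ℕ} (S : Finset (Fin m)) (V : ℝ) (R : Finset (Fin m)) : ℝ :=
  if S ⊆ R then V else 0

theorem singleMinded_nonneg {m : ℕ} (S : Finset (Fin m)) {V : ℝ} (hV : 0 ≤ V)
    (R : Finset (Fin m)) : 0 ≤ singleMinded S V R := by
  unfold singleMinded; split_ifs <;> simp [hV]

/-- A nonempty superadditive set `T` is a proper subset of `S`. If `T` contained `S`, its margin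
would vanish. Its margin is positive, so `R ∪ T` covers `S`, and then `S ∩ T` already has the same
margin, which forces `T ⊆ S`. -/
theorem inSAW_singleMinded {m d : ℕ} {S : Finset (Fin m)} {V : ℝ} (hS : S.Nonempty)
    (hd : S.card ≤ d + 1) (hV : 0 ≤ V) : InSAW d (singleMinded S V) := by
  refine ⟨?_, ?_, ?_⟩
  · simp [singleMinded, hS.ne_empty]
  · intro A B hAB
    unfold singleMinded
    by_cases hA : S ⊆ A
    · simp [hA, hA.trans hAB]
    · simp only [hA, if_false]
      split_ifs <;> simp [hV]
  · unfold superadditiveWidth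
    refine Finset.sup_le fun T hT => ?_
    simp only [Finset.mem_filter, Finset.mem_univ, true_and] at hT
    obtain ⟨R, -, hR⟩ := hT
    rcases T.eq_empty_or_nonempty with rfl | hne
    · simp
    have h0 := hR ∅ (Finset.empty_ssubset.2 hne)
    have hnot : ¬ S ⊆ T := by
      intro h
      have : S ⊆ R ∪ T := h.trans Finset.subset_union_right
      simp only [margin, singleMinded, h, this, if_true, Finset.union_empty,
        Finset.subset_empty, hS.ne_empty, if_false] at h0
      split_ifs at h0 <;> linarith
    have hsub : S ⊆ R ∪ T := by
      by_contra h
      simp only [margin, singleMinded, h, hnot, Finset.union_empty,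
        Finset.subset_empty, hS.ne_empty, if_false] at h0
      split_ifs at h0 <;> linarith
    have hTS : T ⊆ S := by
      by_contra h
      have hlt : S ∩ T ⊂ T := by
        refine Finset.ssubset_iff_subset_ne.2 ⟨Finset.inter_subset_right, fun he => h ?_⟩
        rw [← he]; exact Finset.inter_subset_left
      have h1 := hR _ hlt
      have e1 : S ⊆ R ∪ S ∩ T := by
        intro x hx
        have := hsub hx
        simp only [Finset.mem_union, Finset.mem_inter] at this ⊢
        tauto
      have e2 : ¬ S ⊆ S ∩ T := fun h => hnot (h.trans Finset.inter_subset_right)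
      simp only [margin, singleMinded, e1, e2, hsub, hnot, if_true, if_false] at h1
      linarith
    have : T ⊂ S := Finset.ssubset_iff_subset_ne.2 ⟨hTS, fun h => hnot h.ge⟩
    have := Finset.card_lt_card this
    omega

/-- Payments need not be assumed integrable: for finite `B`, an infinite `D` would make the
right-hand difference `⊥`, below any left-hand one. -/
theorem ENNReal.add_le_add_of_coe_sub_le {A B C D : ℝ≥0∞} (hC : C ≠ ⊤)
    (h : ((A : ℝ≥0∞) : EReal) - (B : EReal) ≤ (C : EReal) - (D : EReal)) : A + D ≤ C + B := by
  by_cases hB : B = ⊤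
  · simp [hB]
  lift B to ℝ≥0 using hB
  lift C to ℝ≥0 using hC
  by_cases hD : D = ⊤
  · subst hD
    exfalso
    by_cases hA : A = ⊤
    · subst hA
      simp at h
    · lift A to ℝ≥0 using hA
      simp only [EReal.coe_ennreal_top, EReal.sub_top, le_bot_iff] at h
      exact absurd h (EReal.coe_ne_bot ((A : ℝ) - B))
  lift D to ℝ≥0 using hD
  by_cases hA : A = ⊤
  · subst hA
    exfalso
    have : ((C : ℝ) : EReal) - ((D : ℝ) : EReal) = ((C - D : ℝ) : EReal) := rfl
    simp only [EReal.coe_ennreal_top] at h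
    have h2 : (⊤ : EReal) - ((B : ℝ) : EReal) ≤ ((C - D : ℝ) : EReal) := h
    rw [EReal.top_sub_coe, top_le_iff] at h2
    exact EReal.coe_ne_top _ h2
  · lift A to ℝ≥0 using hA
    have h2 : ((A - B : ℝ) : EReal) ≤ ((C - D : ℝ) : EReal) := h
    rw [EReal.coe_le_coe_iff] at h2
    have : (A : ℝ) + D ≤ C + B := by linarith
    exact_mod_cast this

/-! ### Uniform laws on finitely many action profiles -/

section UniformLaw

/-- The law of the profile `a ω` for a uniformly random `ω`. -/
noncomputable def uniformLaw {Ω X : Type*} [Fintype Ω] [MeasurableSpace X] (a : Ω → X) :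
    Measure X :=
  (Fintype.card Ω : ℝ≥0∞)⁻¹ • ∑ ω, Measure.dirac (a ω)

theorem lintegral_uniformLaw {Ω X : Type*} [Fintype Ω] [MeasurableSpace X]
    [MeasurableSingletonClass X] (a : Ω → X) (f : X → ℝ≥0∞) :
    ∫⁻ x, f x ∂uniformLaw a = (Fintype.card Ω : ℝ≥0∞)⁻¹ * ∑ ω, f (a ω) := by
  rw [uniformLaw, lintegral_smul_measure, lintegral_finsetSum_measure]
  simp [lintegral_dirac]

theorem isProbabilityMeasure_uniformLaw {Ω X : Type*} [Fintype Ω] [Nonempty Ω]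
    [MeasurableSpace X] (a : Ω → X) : IsProbabilityMeasure (uniformLaw a) := by
  constructor
  simp only [uniformLaw, Measure.smul_apply, Measure.finsetSum_apply, measure_univ,
    Finset.sum_const, Finset.card_univ, nsmul_eq_mul, mul_one, smul_eq_mul]
  exact ENNReal.inv_mul_cancel (by simp) (by simp)

theorem lintegral_uniformLaw_ofReal {Ω X : Type*} [Fintype Ω] [Nonempty Ω] [MeasurableSpace X]
    [MeasurableSingletonClass X] (a : Ω → X) (f : X → ℝ) (hf : ∀ x, 0 ≤ f x) :
    ∫⁻ x, ENNReal.ofReal (f x) ∂uniformLaw a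
      = ENNReal.ofReal ((Fintype.card Ω : ℝ)⁻¹ * ∑ ω, f (a ω)) := by
  rw [lintegral_uniformLaw, ENNReal.ofReal_mul (by positivity),
    ENNReal.ofReal_sum_of_nonneg fun _ _ => hf _, ENNReal.ofReal_inv_of_pos (by positivity),
    ENNReal.ofReal_natCast]

variable {n m : ℕ} {Ω : Type*} [Fintype Ω] [Nonempty Ω] {M : Auction n m} {v : Valuations n m}
  [MeasurableSingletonClass M.Action]

theorem expectedUtility_uniformLaw (hv : ∀ i R, 0 ≤ v i R) (a : Ω → Fin n → M.Action) (i : Fin n)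
    (φ : (Fin n → M.Action) → (Fin n → M.Action)) :
    expectedUtility M v i (uniformLaw a) φ = (((Fintype.card Ω : ℝ)⁻¹ *
      ∑ ω, (v i (M.alloc (φ (a ω)) i) - (M.pay (φ (a ω)) i : ℝ)) : ℝ) : EReal) := by
  have h1 := lintegral_uniformLaw_ofReal a (fun x => v i (M.alloc (φ x) i)) fun _ => hv _ _
  have h2 := lintegral_uniformLaw_ofReal a (fun x => (M.pay (φ x) i : ℝ)) fun _ => NNReal.coe_nonneg _
  simp only [ENNReal.ofReal_coe_nnreal] at h2
  rw [expectedUtility, h1, h2, EReal.coe_ennreal_ofReal, EReal.coe_ennreal_ofReal,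
    max_eq_left, max_eq_left, ← EReal.coe_sub, ← mul_sub, Finset.sum_sub_distrib]
  · exact mul_nonneg (by positivity) (Finset.sum_nonneg fun _ _ => NNReal.coe_nonneg _)
  · exact mul_nonneg (by positivity) (Finset.sum_nonneg fun _ _ => hv _ _)

theorem uniformLaw_mem_coarseCorrelated (hv : ∀ i R, 0 ≤ v i R) (a : Ω → Fin n → M.Action)
    (h : ∀ i a', ∑ ω, (v i (M.alloc (Function.update (a ω) i a') i)
        - (M.pay (Function.update (a ω) i a') i : ℝ))
      ≤ ∑ ω, (v i (M.alloc (a ω) i) - (M.pay (a ω) i : ℝ))) :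
    uniformLaw a ∈ coarseCorrelated M v := by
  refine ⟨isProbabilityMeasure_uniformLaw a, fun i a' => ?_⟩
  rw [expectedUtility_uniformLaw hv, expectedUtility_uniformLaw hv, EReal.coe_le_coe_iff]
  exact mul_le_mul_of_nonneg_left (h i a') (by positivity)

end UniformLaw

instance {n m : ℕ} (π : Equiv.Perm (Fin n)) :
    MeasurableSingletonClass (singleBidAuction m π).Action :=
  inferInstanceAs (MeasurableSingletonClass (ℝ≥0 × PurchasePlan m))

instance {n m : ℕ} (π : Equiv.Perm (Fin n)) :
    MeasurableSingletonClass (simultaneousItemAuction m π).Action :=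
  inferInstanceAs (MeasurableSingletonClass (Fin m → ℝ≥0))

/-! ### Order of service and purchases in the Single-bid Auction -/

/-- What a purchase plan buys from the available items. -/
def PurchasePlan.buy {m : ℕ} (r : PurchasePlan m) : Finset (Fin m) → Finset (Fin m) := r.1

theorem PurchasePlan.buy_subset {m : ℕ} (r : PurchasePlan m) (R : Finset (Fin m)) :
    r.buy R ⊆ R := r.2 R

section Precedence

variable {n m : ℕ} {π : Equiv.Perm (Fin n)} {b : Fin n → ℝ≥0}

theorem Precedes.trans {i j l : Fin n} (h₁ : Precedes π b i j) (h₂ : Precedes π b j l) :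
    Precedes π b i l := by
  unfold Precedes at *
  rcases h₁ with h₁ | ⟨h₁, h₁'⟩ <;> rcases h₂ with h₂ | ⟨h₂, h₂'⟩
  · exact Or.inl (h₂.trans h₁)
  · exact Or.inl (h₂ ▸ h₁)
  · exact Or.inl (h₁ ▸ h₂)
  · exact Or.inr ⟨h₁.trans h₂, h₁'.trans h₂'⟩

theorem Precedes.irrefl (i : Fin n) : ¬ Precedes π b i i := by
  simp [Precedes]

theorem Precedes.total {i j : Fin n} (h : i ≠ j) : Precedes π b i j ∨ Precedes π b j i := by
  unfold Precedes
  have h' : π i ≠ π j := fun e => h (π.injective e)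
  rcases lt_trichotomy (b i) (b j) with hb | hb | hb
  · exact Or.inr (Or.inl hb)
  · rcases lt_or_gt_of_ne h' with hp | hp
    · exact Or.inl (Or.inr ⟨hb, hp⟩)
    · exact Or.inr (Or.inr ⟨hb.symm, hp⟩)
  · exact Or.inl (Or.inl hb)

theorem Precedes.of_lt {i j : Fin n} (h : b j < b i) : Precedes π b i j := Or.inl h

theorem Precedes.le {i j : Fin n} (h : Precedes π b i j) : b j ≤ b i := by
  rcases h with h | h
  · exact h.le
  · exact h.1.ge

theorem turn_lt_turn {i j : Fin n} (h : Precedes π b i j) : turn π b i < turn π b j := by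
  classical
  unfold turn
  refine Finset.card_lt_card (Finset.ssubset_iff_of_subset ?_ |>.2 ⟨i, ?_, ?_⟩)
  · intro l hl
    simp only [Finset.mem_filter, Finset.mem_univ, true_and] at hl ⊢
    exact hl.trans h
  · simpa using h
  · simpa using Precedes.irrefl i

theorem turn_lt_turn_iff {i j : Fin n} : turn π b i < turn π b j ↔ Precedes π b i j := by
  refine ⟨fun h => ?_, turn_lt_turn⟩
  by_contra hn
  have hne : i ≠ j := by rintro rfl; exact lt_irrefl _ h
  have := turn_lt_turn ((Precedes.total hne).resolve_left hn)
  omega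

theorem turn_lt (i : Fin n) : turn π b i < n := by
  classical
  unfold turn
  have : (Finset.univ.filter fun j => Precedes π b j i) ⊂ Finset.univ := by
    refine Finset.ssubset_iff_of_subset (Finset.subset_univ _) |>.2 ⟨i, Finset.mem_univ _, ?_⟩
    simpa using Precedes.irrefl i
  simpa using Finset.card_lt_card this

variable {r : Fin n → PurchasePlan m}

open Classical in
theorem purchases_succ (t : ℕ) (i : Fin n) :
    purchases π b r (t + 1) i = if turn π b i = t then
        (r i).buy (Finset.univ \ Finset.univ.biUnion (purchases π b r t))
      else purchases π b r t i := by
  rw [purchases]; rfl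

theorem purchases_of_turn_lt {i : Fin n} {t : ℕ} (h : turn π b i < t) :
    purchases π b r t i = purchases π b r (turn π b i + 1) i := by
  induction t with
  | zero => omega
  | succ t ih =>
    rcases Nat.lt_succ_iff_lt_or_eq.1 h with h | h
    · rw [← ih h, purchases_succ, if_neg h.ne]
    · rw [h]

theorem purchases_of_le_turn {i : Fin n} {t : ℕ} (h : t ≤ turn π b i) :
    purchases π b r t i = ∅ := by
  induction t with
  | zero => rfl
  | succ t ih => rw [purchases_succ, if_neg (by omega), ih (by omega)]

open Classical in
/-- What an agent buys is determined by the purchases of the agents that come before. -/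
theorem purchases_eq (i : Fin n) :
    purchases π b r n i = (r i).buy (Finset.univ \
      (Finset.univ.filter fun j => Precedes π b j i).biUnion (purchases π b r n)) := by
  rw [purchases_of_turn_lt (turn_lt i), purchases_succ, if_pos rfl]
  congr 2
  ext x
  simp only [Finset.mem_biUnion, Finset.mem_univ, true_and, Finset.mem_filter]
  constructor
  · rintro ⟨j, hj⟩
    by_cases h : turn π b j < turn π b i
    · refine ⟨j, turn_lt_turn_iff.1 h, ?_⟩
      rwa [purchases_of_turn_lt (turn_lt j), ← purchases_of_turn_lt h]
    · rw [purchases_of_le_turn (by omega)] at hj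
      simp at hj
  · rintro ⟨j, hji, hj⟩
    refine ⟨j, ?_⟩
    rwa [purchases_of_turn_lt (turn_lt_turn hji), ← purchases_of_turn_lt (turn_lt j)]

theorem notMem_purchases_of_precedes {i j : Fin n} (h : Precedes π b j i) {x : Fin m}
    (hx : x ∈ purchases π b r n i) : x ∉ purchases π b r n j := by
  classical
  intro hj
  rw [purchases_eq] at hx
  have := (r i).buy_subset _ hx
  simp only [Finset.mem_sdiff, Finset.mem_univ, true_and, Finset.mem_biUnion,
    Finset.mem_filter, not_exists, not_and] at this
  exact this j h hj

theorem eq_of_mem_purchases {i j : Fin n} {x : Fin m} (hi : x ∈ purchases π b r n i)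
    (hj : x ∈ purchases π b r n j) : i = j := by
  by_contra hne
  rcases Precedes.total (π := π) (b := b) hne with h | h
  · exact notMem_purchases_of_precedes h hj hi
  · exact notMem_purchases_of_precedes h hi hj

/-- The plan to buy the item `x` whenever it is available, and nothing else. -/
def PurchasePlan.single (x : Fin m) : PurchasePlan m :=
  ⟨fun R => R ∩ {x}, fun _ => Finset.inter_subset_left⟩

theorem PurchasePlan.buy_single (x : Fin m) (R : Finset (Fin m)) :
    (PurchasePlan.single x).buy R = R ∩ {x} := rfl

/-- The plan to buy nothing. -/
def PurchasePlan.none (m : ℕ) : PurchasePlan m := ⟨fun _ => ∅, fun _ => Finset.empty_subset _⟩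

theorem purchases_single_subset {i : Fin n} {x : Fin m} (h : r i = PurchasePlan.single x) :
    purchases π b r n i ⊆ {x} := by
  classical
  rw [purchases_eq, h]
  exact Finset.inter_subset_right

theorem notMem_purchases_of_single {i j : Fin n} {x : Fin m} (h : r j = PurchasePlan.single x)
    (hji : Precedes π b j i) : x ∉ purchases π b r n i := by
  classical
  intro hi
  refine notMem_purchases_of_precedes hji hi ?_
  rw [purchases_eq, h]
  simp only [PurchasePlan.buy_single, Finset.mem_inter, Finset.mem_sdiff, Finset.mem_univ, true_and,
    Finset.mem_biUnion, Finset.mem_filter, not_exists, not_and, Finset.mem_singleton, and_true]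
  exact fun l hl => notMem_purchases_of_precedes (hl.trans hji) hi

/-- If one agent buys all items, anyone else can get an item by outbidding that agent. -/
theorem mem_purchases_update {i₀ i : Fin n} (hne : i ≠ i₀) (x : Fin m)
    (hall : purchases π b r n i₀ = Finset.univ) {b' : Fin n → ℝ≥0} {r' : Fin n → PurchasePlan m}
    (hb' : ∀ j, j ≠ i → b' j = b j) (hr' : ∀ j, j ≠ i → r' j = r j)
    (hi : r' i = PurchasePlan.single x) (hlt : b i₀ < b' i) :
    x ∈ purchases π b' r' n i := by
  classical
  have hempty : ∀ j, j ≠ i₀ → purchases π b r n j = ∅ := by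
    intro j hj
    refine Finset.eq_empty_of_forall_notMem fun y hy => hj ?_
    exact eq_of_mem_purchases hy (by rw [hall]; exact Finset.mem_univ _)
  -- Whoever precedes `i` now bids more than `b i₀`, so came before `i₀` originally and declined the
  -- full set of items. By induction on the turn, the full set is offered again and declined again.
  have hnone : ∀ t j, turn π b' j < t → Precedes π b' j i → purchases π b' r' n j = ∅ := by
    intro t
    induction t with
    | zero => intro j hj; omega
    | succ t ih =>
      intro j hj hji
      have hji' : j ≠ i := by rintro rfl; exact Precedes.irrefl _ hji
      have hle := hji.le
      rw [hb' j hji'] at hle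
      have hpre : Precedes π b j i₀ := Precedes.of_lt (hlt.trans_le hle)
      have hj0 : j ≠ i₀ := by rintro rfl; exact Precedes.irrefl _ hpre
      have h1 : (r j).buy Finset.univ = ∅ := by
        have := hempty j hj0
        rw [purchases_eq] at this
        convert this using 2
        symm
        rw [Finset.sdiff_eq_self_iff_disjoint, Finset.disjoint_biUnion_right]
        intro l hl
        rw [hempty l]
        · simp
        · rintro rfl
          exact Precedes.irrefl _ (hpre.trans (Finset.mem_filter.1 hl).2)
      rw [purchases_eq, hr' j hji']
      convert h1 using 2
      rw [Finset.sdiff_eq_self_iff_disjoint, Finset.disjoint_biUnion_right]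
      intro l hl
      have hl := (Finset.mem_filter.1 hl).2
      rw [ih l (by have := turn_lt_turn hl; omega) (hl.trans hji)]
      simp
  rw [purchases_eq, hi]
  simp only [PurchasePlan.buy_single, Finset.mem_inter, Finset.mem_sdiff, Finset.mem_univ, true_and,
    Finset.mem_biUnion, Finset.mem_filter, not_exists, not_and, Finset.mem_singleton, and_true]
  intro l hl
  rw [hnone _ l (Nat.lt_succ_self _) hl]
  simp

end Precedence

/-! ### Equilibrium inequalities for arbitrary laws -/

section CoarseCorrelated

variable {n m : ℕ} {M : Auction n m} {v : Valuations n m} {μ : Measure (Fin n → M.Action)}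

/-- The lower integral is superadditive without measurability, so allocations need not be shown
measurable. -/
theorem sum_lintegral_le_lintegral_sum {α κ : Type*} [MeasurableSpace α] (ν : Measure α)
    (s : Finset κ) (f : κ → α → ℝ≥0∞) : ∑ i ∈ s, ∫⁻ a, f i a ∂ν ≤ ∫⁻ a, ∑ i ∈ s, f i a ∂ν := by
  classical
  induction s using Finset.induction_on with
  | empty => simp
  | insert i s hi ih =>
    simp only [Finset.sum_insert hi]
    exact (add_le_add le_rfl ih).trans (le_lintegral_add _ _)

theorem lintegral_ofReal_alloc_ne_top [IsProbabilityMeasure μ] {i : Fin n} (hv : Monotone (v i)) :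
    ∫⁻ a, ENNReal.ofReal (v i (M.alloc a i)) ∂μ ≠ ⊤ := by
  refine ne_top_of_le_ne_top (b := ENNReal.ofReal (v i Finset.univ)) ENNReal.ofReal_ne_top ?_
  calc ∫⁻ a, ENNReal.ofReal (v i (M.alloc a i)) ∂μ
      ≤ ∫⁻ _, ENNReal.ofReal (v i Finset.univ) ∂μ :=
        lintegral_mono fun a => ENNReal.ofReal_le_ofReal (hv (Finset.subset_univ _))
    _ = _ := by simp

/-- The equilibrium inequality, with the payments moved to the other side. -/
theorem lintegral_add_le_of_coarseCorrelated (h : μ ∈ coarseCorrelated M v) {i : Fin n}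
    (hv : Monotone (v i)) (a' : M.Action) :
    ∫⁻ a, ENNReal.ofReal (v i (M.alloc (Function.update a i a') i)) ∂μ
        + ∫⁻ a, (M.pay a i : ℝ≥0∞) ∂μ
      ≤ ∫⁻ a, ENNReal.ofReal (v i (M.alloc a i)) ∂μ
        + ∫⁻ a, (M.pay (Function.update a i a') i : ℝ≥0∞) ∂μ := by
  have := h.1
  exact ENNReal.add_le_add_of_coe_sub_le (lintegral_ofReal_alloc_ne_top hv) (h.2 i a')

end CoarseCorrelated

theorem ofReal_singleMinded {m : ℕ} (S R : Finset (Fin m)) (V : ℝ) :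
    ENNReal.ofReal (singleMinded S V R) = ENNReal.ofReal V * (if S ⊆ R then 1 else 0) := by
  unfold singleMinded; split_ifs <;> simp

theorem singleMinded_monotone {m : ℕ} (S : Finset (Fin m)) {V : ℝ} (hV : 0 ≤ V) :
    Monotone (singleMinded S V) := by
  intro A B hAB
  unfold singleMinded
  by_cases hA : S ⊆ A
  · simp [hA, hA.trans hAB]
  · simp only [hA, if_false]
    split_ifs <;> simp [hV]

theorem singleBidAuction_pay {n m : ℕ} (π : Equiv.Perm (Fin n))
    (a : Fin n → (singleBidAuction m π).Action) (i : Fin n) :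
    (singleBidAuction m π).pay a i
      = (a i).1 * (((singleBidAuction m π).alloc a i).card : ℝ≥0) := rfl

/-! ### Single-bid Auction: every equilibrium has low welfare -/

/-- One agent wants all of the `d + 1` items, for a value of `d + 1`; the `k` others want the
item `0`, for a value of `1 + 2 * g`. -/
noncomputable def bundleVersusItem (d k : ℕ) (g : ℝ≥0) : Valuations (k + 1) (d + 1) :=
  Fin.cons (singleMinded Finset.univ ((d : ℝ) + 1)) (fun _ => singleMinded {0} (1 + 2 * (g : ℝ)))

section SingleBid

variable {d k : ℕ} {g : ℝ≥0} {π : Equiv.Perm (Fin (k + 1))}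

theorem bundleVersusItem_zero : bundleVersusItem d k g 0
    = singleMinded Finset.univ ((d : ℝ) + 1) := rfl

theorem bundleVersusItem_succ (i : Fin k) : bundleVersusItem d k g i.succ
    = singleMinded {0} (1 + 2 * (g : ℝ)) := rfl

theorem inSAW_bundleVersusItem (i : Fin (k + 1)) : InSAW d (bundleVersusItem d k g i) := by
  refine Fin.cases ?_ (fun i => ?_) i
  · rw [bundleVersusItem_zero]
    exact inSAW_singleMinded ⟨0, Finset.mem_univ _⟩ (by simp) (by positivity)
  · rw [bundleVersusItem_succ]
    exact inSAW_singleMinded (by simp) (by simp) (by positivity)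

theorem ofReal_one_add_two_mul : ENNReal.ofReal (1 + 2 * (g : ℝ)) = 1 + 2 * (g : ℝ≥0∞) := by
  rw [ENNReal.ofReal_add (by norm_num) (by positivity), ENNReal.ofReal_mul (by norm_num)]
  simp

theorem sum_item_le_one (a : Fin (k + 1) → (singleBidAuction (d + 1) π).Action) :
    ∑ i : Fin k, (if 0 ∈ (singleBidAuction (d + 1) π).alloc a i.succ
        then (1 : ℝ≥0∞) else 0) ≤ 1 := by
  rw [Finset.sum_boole]
  have : (Finset.univ.filter fun i : Fin k =>
      0 ∈ (singleBidAuction (d + 1) π).alloc a i.succ).card ≤ 1 := by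
    refine Finset.card_le_one.2 fun i hi j hj => ?_
    exact Fin.succ_injective _
      (eq_of_mem_purchases (Finset.mem_filter.1 hi).2 (Finset.mem_filter.1 hj).2)
  exact_mod_cast this

variable {μ : Measure (Fin (k + 1) → (singleBidAuction (d + 1) π).Action)}

/-- The deviation is to bid `1 + g` for item `0` alone. It wins whenever the bundle agent took
everything at a lower bid, and each win nets `g`; the equilibrium utility is at most the expected
value. -/
theorem lintegral_bundle_low_le
    (h : μ ∈ coarseCorrelated (singleBidAuction (d + 1) π) (bundleVersusItem d k g)) (i : Fin k) :
    g * ∫⁻ a, (if (singleBidAuction (d + 1) π).alloc a 0 = Finset.univ ∧ (a 0).1 < 1 + g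
        then (1 : ℝ≥0∞) else 0) ∂μ
      ≤ (1 + 2 * g) * ∫⁻ a, (if 0 ∈ (singleBidAuction (d + 1) π).alloc a i.succ
        then (1 : ℝ≥0∞) else 0) ∂μ := by
  classical
  have := h.1
  set a' : (singleBidAuction (d + 1) π).Action := (1 + g, PurchasePlan.single 0) with ha'
  have hcce := lintegral_add_le_of_coarseCorrelated h
    (i := i.succ) (singleMinded_monotone _ (by positivity)) a'
  simp only [bundleVersusItem_succ, ofReal_singleMinded, ofReal_one_add_two_mul] at hcce
  have hpay : ∀ a : Fin (k + 1) → (singleBidAuction (d + 1) π).Action,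
      ((singleBidAuction (d + 1) π).pay (Function.update a i.succ a') i.succ : ℝ≥0∞)
        = (1 + g) * (if {0} ⊆ (singleBidAuction (d + 1) π).alloc
            (Function.update a i.succ a') i.succ then 1 else 0) := by
    intro a
    have hs : (singleBidAuction (d + 1) π).alloc (Function.update a i.succ a') i.succ ⊆ {0} :=
      purchases_single_subset (congrArg Prod.snd (Function.update_self i.succ a' a))
    have hp : (singleBidAuction (d + 1) π).pay (Function.update a i.succ a') i.succ
      = (1 + g) * (((singleBidAuction (d + 1) π).alloc
            (Function.update a i.succ a') i.succ).card : ℝ≥0) := by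
      rw [singleBidAuction_pay, Function.update_self]
    rw [hp]
    rcases Finset.subset_singleton_iff.1 hs with h0 | h0 <;> rw [h0] <;> simp
  simp only [hpay] at hcce
  rw [lintegral_const_mul' _ _ (by finiteness), lintegral_const_mul' _ _ (by finiteness),
    lintegral_const_mul' _ _ (by finiteness)] at hcce
  set I := ∫⁻ a, (if {0} ⊆ (singleBidAuction (d + 1) π).alloc
            (Function.update a i.succ a') i.succ then (1 : ℝ≥0∞) else 0) ∂μ with hI
  have hIle : I ≤ 1 := by
    calc I ≤ ∫⁻ _, 1 ∂μ := lintegral_mono fun a => by dsimp only; split_ifs <;> simp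
      _ = 1 := by simp
  have hIt : I ≠ ⊤ := ne_top_of_le_ne_top ENNReal.one_ne_top hIle
  simp only [Finset.singleton_subset_iff] at hcce
  have h1 : (g : ℝ≥0∞) * I + (1 + g) * I ≤ (1 + 2 * g) *
      ∫⁻ a, (if 0 ∈ (singleBidAuction (d + 1) π).alloc a i.succ then 1 else 0) ∂μ
        + (1 + g) * I := by
    refine le_trans (le_of_eq ?_) (le_self_add.trans hcce)
    ring
  have h2 := (ENNReal.add_le_add_iff_right (by finiteness)).1 h1
  refine le_trans ?_ h2
  gcongr
  refine lintegral_mono fun a => ?_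
  dsimp only
  split_ifs with ha hb hb
  · exact le_rfl
  · exfalso
    refine hb ?_
    rw [Finset.singleton_subset_iff]
    refine mem_purchases_update (i₀ := 0) (Fin.succ_ne_zero i) 0 ha.1 ?_ ?_ ?_ ?_
    · intro j hj; simp [hj]
    · intro j hj; simp [hj]
    · exact congrArg Prod.snd (Function.update_self i.succ a' a)
    · exact ha.2.trans_eq (congrArg Prod.fst (Function.update_self i.succ a' a)).symm
  · exact zero_le
  · exact le_rfl

theorem lintegral_ite_ne_top {α : Type*} [MeasurableSpace α] (ν : Measure α)
    [IsProbabilityMeasure ν] (p : α → Prop) [DecidablePred p] :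
    ∫⁻ a, (if p a then (1 : ℝ≥0∞) else 0) ∂ν ≠ ⊤ := by
  refine ne_top_of_le_ne_top ENNReal.one_ne_top ?_
  calc _ ≤ ∫⁻ _, 1 ∂ν := lintegral_mono fun a => by dsimp only; split_ifs <;> simp
    _ = 1 := by simp

/-- Splitting along a measurable set is additive for every integrand, so only `q` (a threshold on a
bid) must be measurable. -/
theorem lintegral_ite_split {α : Type*} [MeasurableSpace α] (ν : Measure α)
    (p q : α → Prop) [DecidablePred p] [DecidablePred q] (hq : MeasurableSet {a | q a}) :
    ∫⁻ a, (if p a then (1 : ℝ≥0∞) else 0) ∂ν =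
      ∫⁻ a, (if p a ∧ q a then (1 : ℝ≥0∞) else 0) ∂ν
      + ∫⁻ a, (if p a ∧ ¬ q a then (1 : ℝ≥0∞) else 0) ∂ν := by
  rw [← lintegral_add_compl _ hq, ← lintegral_indicator hq, ← lintegral_indicator hq.compl]
  congr 1 <;> refine lintegral_congr fun a => ?_ <;> by_cases ha : q a <;>
    simp [Set.indicator, ha]

theorem lintegral_bundle_eq_add (b : ℝ≥0) :
    ∫⁻ a, (if (singleBidAuction (d + 1) π).alloc a 0 = Finset.univ
        then (1 : ℝ≥0∞) else 0) ∂μ =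
      ∫⁻ a, (if (singleBidAuction (d + 1) π).alloc a 0 = Finset.univ ∧ (a 0).1 < b
        then (1 : ℝ≥0∞) else 0) ∂μ
      + ∫⁻ a, (if (singleBidAuction (d + 1) π).alloc a 0 = Finset.univ ∧ ¬ (a 0).1 < b
        then (1 : ℝ≥0∞) else 0) ∂μ := by
  refine lintegral_ite_split μ _ _ ?_
  have : Measurable fun a : Fin (k + 1) → (singleBidAuction (d + 1) π).Action => (a 0).1 :=
    (measurable_fst (α := ℝ≥0) (β := PurchasePlan (d + 1))).comp (measurable_pi_apply 0)
  exact measurableSet_lt this measurable_const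

/-- Buying nothing guarantees utility zero, so the expected payment is at most the expected value.
-/
theorem lintegral_bundle_pay_le
    (h : μ ∈ coarseCorrelated (singleBidAuction (d + 1) π) (bundleVersusItem d k g)) :
    ∫⁻ a, ((singleBidAuction (d + 1) π).pay a 0 : ℝ≥0∞) ∂μ
      ≤ (d + 1) * ∫⁻ a, (if (singleBidAuction (d + 1) π).alloc a 0 = Finset.univ
        then (1 : ℝ≥0∞) else 0) ∂μ := by
  set a' : (singleBidAuction (d + 1) π).Action := (0, PurchasePlan.none _) with ha'
  have hcce := lintegral_add_le_of_coarseCorrelated h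
    (i := 0) (singleMinded_monotone _ (by positivity)) a'
  have hpay0 : ∀ a : Fin (k + 1) → (singleBidAuction (d + 1) π).Action,
      (singleBidAuction (d + 1) π).pay (Function.update a 0 a') 0 = 0 := by
    intro a
    rw [singleBidAuction_pay, Function.update_self, zero_mul]
  have hd : ENNReal.ofReal ((d : ℝ) + 1) = (d : ℝ≥0∞) + 1 := by
    rw [ENNReal.ofReal_add (by positivity) (by norm_num)]; simp
  simp only [hpay0, ENNReal.coe_zero, lintegral_zero, add_zero] at hcce
  refine le_add_self.trans (hcce.trans (le_of_eq ?_))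
  rw [← hd, ← lintegral_const_mul' _ _ (by finiteness)]
  refine lintegral_congr fun a => ?_
  rw [bundleVersusItem_zero, ofReal_singleMinded]
  simp only [Finset.univ_subset_iff]

/-- A win at a bid of at least `1 + g` loses at least `g * (d + 1)`, while a win at a lower bid
gains at most `d + 1`. The total is nonnegative. -/
theorem lintegral_bundle_high_le
    (h : μ ∈ coarseCorrelated (singleBidAuction (d + 1) π) (bundleVersusItem d k g)) :
    g * ∫⁻ a, (if (singleBidAuction (d + 1) π).alloc a 0 = Finset.univ ∧ ¬ (a 0).1 < 1 + g
        then (1 : ℝ≥0∞) else 0) ∂μ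
      ≤ ∫⁻ a, (if (singleBidAuction (d + 1) π).alloc a 0 = Finset.univ ∧ (a 0).1 < 1 + g
        then (1 : ℝ≥0∞) else 0) ∂μ := by
  have := h.1
  have hle := lintegral_bundle_pay_le h
  rw [lintegral_bundle_eq_add (1 + g)] at hle
  have hfin := lintegral_ite_ne_top μ fun a : Fin (k + 1) → (singleBidAuction (d + 1) π).Action =>
    (singleBidAuction (d + 1) π).alloc a 0 = Finset.univ ∧ ¬ (a 0).1 < 1 + g
  have hpay : (d + 1 : ℝ≥0∞) * (1 + g) * ∫⁻ a, (if (singleBidAuction (d + 1) π).alloc a 0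
        = Finset.univ ∧ ¬ (a 0).1 < 1 + g then (1 : ℝ≥0∞) else 0) ∂μ
      ≤ ∫⁻ a, ((singleBidAuction (d + 1) π).pay a 0 : ℝ≥0∞) ∂μ := by
    rw [← lintegral_const_mul' _ _ (by finiteness)]
    refine lintegral_mono fun a => ?_
    dsimp only
    split_ifs with ha
    · rw [singleBidAuction_pay, ha.1, mul_one, mul_comm]
      have h3 := not_lt.1 ha.2
      have : (1 + g) * ((d : ℝ≥0) + 1)
          ≤ (a 0).1 * ((Finset.univ : Finset (Fin (d + 1))).card : ℝ≥0) := by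
        simp only [Finset.card_univ, Fintype.card_fin, Nat.cast_add, Nat.cast_one]
        gcongr
      exact_mod_cast this
    · simp
  revert hfin hpay hle
  generalize ∫⁻ a, (if (singleBidAuction (d + 1) π).alloc a 0 = Finset.univ ∧ (a 0).1 < 1 + g
        then (1 : ℝ≥0∞) else 0) ∂μ = l
  generalize ∫⁻ a, (if (singleBidAuction (d + 1) π).alloc a 0 = Finset.univ ∧ ¬ (a 0).1 < 1 + g
        then (1 : ℝ≥0∞) else 0) ∂μ = w
  intro hle hfin hpay
  have h1 : (d + 1 : ℝ≥0∞) * ((1 + g) * w) ≤ (d + 1) * (l + w) := by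
    rw [← mul_assoc]; exact hpay.trans hle
  have h2 := (ENNReal.mul_le_mul_iff_right (by positivity) (by finiteness)).1 h1
  have h3 : (g : ℝ≥0∞) * w + w ≤ l + w := le_trans (le_of_eq (by ring)) h2
  exact (ENNReal.add_le_add_iff_right hfin).1 h3

theorem sum_lintegral_item_le_one [IsProbabilityMeasure μ] :
    ∑ i : Fin k, ∫⁻ a, (if 0 ∈ (singleBidAuction (d + 1) π).alloc a i.succ
        then (1 : ℝ≥0∞) else 0) ∂μ ≤ 1 := by
  refine (sum_lintegral_le_lintegral_sum _ _ _).trans ?_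
  calc _ ≤ ∫⁻ _, 1 ∂μ := lintegral_mono fun a => sum_item_le_one a
    _ = 1 := by simp

theorem expectedWelfare_bundleVersusItem_le [IsProbabilityMeasure μ] :
    expectedWelfare (singleBidAuction (d + 1) π) (bundleVersusItem d k g) μ
      ≤ (1 + 2 * g) + (d + 1) * ∫⁻ a, (if (singleBidAuction (d + 1) π).alloc a 0 = Finset.univ
        then (1 : ℝ≥0∞) else 0) ∂μ := by
  have hd : ENNReal.ofReal ((d : ℝ) + 1) = (d : ℝ≥0∞) + 1 := by
    rw [ENNReal.ofReal_add (by positivity) (by norm_num)]; simp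
  rw [← lintegral_const_mul' _ _ (by finiteness)]
  calc _ ≤ ∫⁻ a, ((1 + 2 * g : ℝ≥0∞) + (d + 1) *
          (if (singleBidAuction (d + 1) π).alloc a 0 = Finset.univ
            then (1 : ℝ≥0∞) else 0)) ∂μ := ?_
    _ = _ := by rw [lintegral_add_left measurable_const]; simp
  refine lintegral_mono fun a => ?_
  dsimp only
  rw [Fin.sum_univ_succ, bundleVersusItem_zero, ofReal_singleMinded, hd]
  refine (add_comm _ _).trans_le ?_
  simp only [bundleVersusItem_succ, ofReal_singleMinded, ofReal_one_add_two_mul,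
    Finset.singleton_subset_iff, Finset.univ_subset_iff]
  gcongr
  rw [← Finset.mul_sum]
  exact (mul_le_mul_right (sum_item_le_one a) _).trans_eq (mul_one _)

end SingleBid

/-! ### Single-bid Auction: a pure equilibrium and the Price of Stability -/

section SingleBidEquilibrium

variable {d k : ℕ} {g : ℝ≥0} {π : Equiv.Perm (Fin (k + 1))}

/-- All agents who want the item `0` bid their value for it, and the other agent stays out. -/
def bidTheItemValue (d k : ℕ) (g : ℝ≥0) (π : Equiv.Perm (Fin (k + 1))) :
    Fin (k + 1) → (singleBidAuction (d + 1) π).Action :=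
  Fin.cons (0, PurchasePlan.none _) (fun _ => (1 + 2 * g, PurchasePlan.single 0))

theorem notMem_alloc_of_low_bid {i : Fin (k + 1)} {j : Fin k} (hj : j.succ ≠ i)
    {a' : (singleBidAuction (d + 1) π).Action} (h : a'.1 < 1 + 2 * g) :
    0 ∉ (singleBidAuction (d + 1) π).alloc
      (Function.update (bidTheItemValue d k g π) i a') i := by
  have h1 : Function.update (bidTheItemValue d k g π) i a' j.succ
      = (1 + 2 * g, PurchasePlan.single 0) := Function.update_of_ne hj _ _
  have h2 : Function.update (bidTheItemValue d k g π) i a' i = a' := Function.update_self _ _ _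
  refine notMem_purchases_of_single (j := j.succ) (congrArg Prod.snd h1) (Precedes.of_lt ?_)
  exact ((congrArg Prod.fst h2).trans_lt h).trans_eq (congrArg Prod.fst h1).symm

theorem pay_update (a : Fin (k + 1) → (singleBidAuction (d + 1) π).Action) (i : Fin (k + 1))
    (a' : (singleBidAuction (d + 1) π).Action) :
    (((singleBidAuction (d + 1) π).pay (Function.update a i a') i : ℝ≥0) : ℝ)
      = a'.1 * (((singleBidAuction (d + 1) π).alloc (Function.update a i a') i).card : ℝ) := by
  rw [singleBidAuction_pay, Function.update_self]
  push_cast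
  rfl

/-- Every wanted bundle contains item `0`, and getting it against a remaining rival takes a bid of
at least `1 + 2 * g`. That is the full value for a rival, and the bundle agent would pay it on all
`d + 1` items. -/
theorem bidTheItemValue_mem_pureNash (hk : 2 ≤ k) :
    Measure.dirac (bidTheItemValue d k g π)
      ∈ pureNash (singleBidAuction (d + 1) π) (bundleVersusItem d k g) := by
  refine ⟨?_, _, rfl⟩
  have hu : Measure.dirac (bidTheItemValue d k g π)
      = uniformLaw fun _ : Unit => bidTheItemValue d k g π := by simp [uniformLaw]
  rw [hu]
  have hv : ∀ i R, 0 ≤ bundleVersusItem d k g i R := by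
    intro i R
    refine Fin.cases ?_ (fun i => ?_) i
    · exact singleMinded_nonneg _ (by positivity) _
    · exact singleMinded_nonneg _ (by positivity) _
  refine uniformLaw_mem_coarseCorrelated hv _ fun i a' => ?_
  simp only [Finset.univ_unique, Finset.sum_singleton]
  refine le_trans (b := (0 : ℝ)) ?_ ?_
  · rw [pay_update, sub_nonpos]
    -- With two rivals, one who bids the full item value remains whoever deviates.
    obtain ⟨j, hj⟩ : ∃ j : Fin k, j.succ ≠ i := by
      by_contra! hc
      have := (hc ⟨0, by omega⟩).trans (hc ⟨1, by omega⟩).symm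
      simp at this
    have hlow := fun h => notMem_alloc_of_low_bid (g := g) (d := d) (π := π) (a' := a') hj h
    generalize (singleBidAuction (d + 1) π).alloc
      (Function.update (bidTheItemValue d k g π) i a') i = R at hlow ⊢
    by_cases h0 : 0 ∈ R
    · have hb : 1 + 2 * g ≤ a'.1 := not_lt.1 fun h => hlow h h0
      have hb' : 1 + 2 * (g : ℝ) ≤ a'.1 := by exact_mod_cast hb
      have hg : (0 : ℝ) ≤ g := g.2
      have hc : (1 : ℝ) ≤ R.card := by
        exact_mod_cast Finset.card_pos.2 ⟨0, h0⟩
      refine Fin.cases ?_ (fun i => ?_) i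
      · rw [bundleVersusItem_zero]
        unfold singleMinded
        split_ifs with hR
        · rw [Finset.univ_subset_iff] at hR
          rw [hR, Finset.card_univ, Fintype.card_fin]
          push_cast
          nlinarith [(Nat.cast_nonneg d : (0 : ℝ) ≤ d)]
        · positivity
      · rw [bundleVersusItem_succ]
        unfold singleMinded
        split_ifs with hR
        · nlinarith
        · positivity
    · refine le_of_eq_of_le (b := 0) ?_ (by positivity)
      refine Fin.cases ?_ (fun i => ?_) i
      · rw [bundleVersusItem_zero]
        refine if_neg fun h => h0 (h (Finset.mem_univ _))
      · rw [bundleVersusItem_succ]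
        refine if_neg fun h => h0 (h (by simp))
  · rw [singleBidAuction_pay]
    refine Fin.cases ?_ (fun i => ?_) i
    · have : (bidTheItemValue d k g π 0).1 = 0 := rfl
      rw [this, zero_mul, NNReal.coe_zero, sub_zero]
      exact hv _ _
    · have h1 : (bidTheItemValue d k g π i.succ).1 = 1 + 2 * g := rfl
      have hs : (singleBidAuction (d + 1) π).alloc (bidTheItemValue d k g π) i.succ ⊆ {0} :=
        purchases_single_subset rfl
      rw [h1, bundleVersusItem_succ]
      rcases Finset.subset_singleton_iff.1 hs with h0 | h0 <;> rw [h0] <;> simp [singleMinded]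

theorem optWelfare_bundleVersusItem : ENNReal.ofReal ((d : ℝ) + 1)
    ≤ optWelfare (bundleVersusItem d k g) := by
  unfold optWelfare
  refine le_trans ?_ (le_iSup₂ (f := fun (A : Fin (k + 1) → Finset (Fin (d + 1)))
    (_ : A ∈ {A : Fin (k + 1) → Finset (Fin (d + 1)) |
      Pairwise (fun i j => Disjoint (A i) (A j))}) =>
    ∑ i, ENNReal.ofReal (bundleVersusItem d k g i (A i)))
    (Fin.cons Finset.univ fun _ => ∅ : Fin (k + 1) → Finset (Fin (d + 1))) ?_)
  · refine le_trans (le_of_eq ?_) (Finset.single_le_sum (fun _ _ => zero_le)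
      (Finset.mem_univ (0 : Fin (k + 1))))
    rw [Fin.cons_zero, bundleVersusItem_zero]
    simp [singleMinded]
  · intro i j
    refine Fin.cases ?_ (fun i => ?_) i <;> refine Fin.cases ?_ (fun j => ?_) j <;> simp

/-- Let `l` and `w` be the probabilities that the bundle is sold at a low and at a high bid. Summing
over the rivals gives `k * g * l ≤ 1 + 2 * g`, and `g * w ≤ l`; by `hk` the bundle then adds at most
`2 * g` to the welfare. -/
theorem expectedWelfare_bundleVersusItem_le_of_coarse (hg : 0 < g)
    (hk : (1 + 2 * (g : ℝ)) * (d + 1) * (1 + g) ≤ k * g ^ 3 * 2)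
    {μ : Measure (Fin (k + 1) → (singleBidAuction (d + 1) π).Action)}
    (h : μ ∈ coarseCorrelated (singleBidAuction (d + 1) π) (bundleVersusItem d k g)) :
    expectedWelfare (singleBidAuction (d + 1) π) (bundleVersusItem d k g) μ
      ≤ ENNReal.ofReal (1 + 4 * (g : ℝ)) := by
  have := h.1
  refine expectedWelfare_bundleVersusItem_le.trans ?_
  rw [lintegral_bundle_eq_add (1 + g)]
  have hhigh := lintegral_bundle_high_le h
  have hfin1 := lintegral_ite_ne_top μ fun a : Fin (k + 1) → (singleBidAuction (d + 1) π).Action =>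
    (singleBidAuction (d + 1) π).alloc a 0 = Finset.univ ∧ (a 0).1 < 1 + g
  have hfin2 := lintegral_ite_ne_top μ fun a : Fin (k + 1) → (singleBidAuction (d + 1) π).Action =>
    (singleBidAuction (d + 1) π).alloc a 0 = Finset.univ ∧ ¬ (a 0).1 < 1 + g
  have hlow : (k : ℝ≥0∞) * (g * ∫⁻ a, (if (singleBidAuction (d + 1) π).alloc a 0 = Finset.univ
        ∧ (a 0).1 < 1 + g then (1 : ℝ≥0∞) else 0) ∂μ) ≤ 1 + 2 * g := by
    have h1 := Finset.sum_le_sum fun (i : Fin k) (_ : i ∈ Finset.univ) =>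
      lintegral_bundle_low_le h i
    rw [Finset.sum_const, Finset.card_univ, Fintype.card_fin, nsmul_eq_mul, ← Finset.mul_sum] at h1
    refine h1.trans ((mul_le_mul_right sum_lintegral_item_le_one _).trans_eq (mul_one _))
  revert hhigh hfin1 hfin2 hlow
  generalize ∫⁻ a, (if (singleBidAuction (d + 1) π).alloc a 0 = Finset.univ ∧ (a 0).1 < 1 + g
        then (1 : ℝ≥0∞) else 0) ∂μ = l
  generalize ∫⁻ a, (if (singleBidAuction (d + 1) π).alloc a 0 = Finset.univ ∧ ¬ (a 0).1 < 1 + g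
        then (1 : ℝ≥0∞) else 0) ∂μ = w
  intro hhigh hl hw hlow
  lift l to ℝ≥0 using hl
  lift w to ℝ≥0 using hw
  have h1 : (g : ℝ) * w ≤ l := by exact_mod_cast hhigh
  have h2 : (k : ℝ) * (g * l) ≤ 1 + 2 * g := by exact_mod_cast hlow
  have hg' : (0 : ℝ) < g := hg
  have hl0 : (0 : ℝ) ≤ l := l.2
  have hw0 : (0 : ℝ) ≤ w := w.2
  have hkpos : (0 : ℝ) < k := by
    rcases Nat.eq_zero_or_pos k with h0 | h0
    · subst h0
      have : (0 : ℝ) < (1 + 2 * (g : ℝ)) * (d + 1) * (1 + g) := by positivity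
      simp at hk; linarith
    · exact_mod_cast h0
  have key : ((d : ℝ) + 1) * (l + w) ≤ 2 * g := by
    have e1 : (g : ℝ) * (l + w) ≤ (1 + g) * l := by nlinarith
    have e2 : (k : ℝ) * g ^ 2 * (l + w) ≤ (1 + g) * (1 + 2 * g) := by
      calc (k : ℝ) * g ^ 2 * (l + w) = (k * g) * (g * (l + w)) := by ring
        _ ≤ (k * g) * ((1 + g) * l) := by gcongr
        _ = (1 + g) * (k * (g * l)) := by ring
        _ ≤ _ := by gcongr
    have e3 : ((k : ℝ) * g ^ 2) * (((d : ℝ) + 1) * (l + w)) ≤ (k * g ^ 2) * (2 * g) := by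
      calc ((k : ℝ) * g ^ 2) * (((d : ℝ) + 1) * (l + w))
          = ((d : ℝ) + 1) * (k * g ^ 2 * (l + w)) := by ring
        _ ≤ ((d : ℝ) + 1) * ((1 + g) * (1 + 2 * g)) := by gcongr
        _ = (1 + 2 * (g : ℝ)) * (d + 1) * (1 + g) := by ring
        _ ≤ _ := by linarith
    exact le_of_mul_le_mul_left e3 (by positivity)
  have key' : (1 + 2 * g) + ((d : ℝ≥0) + 1) * (l + w) ≤ 1 + 4 * g := by
    rw [← NNReal.coe_le_coe]
    push_cast
    linarith
  have : ENNReal.ofReal (1 + 4 * (g : ℝ)) = ((1 + 4 * g : ℝ≥0) : ℝ≥0∞) := by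
    rw [← ENNReal.ofReal_coe_nnreal]; simp
  rw [this]
  exact_mod_cast key'

/-- The price of stability of the Single-bid Auction comes close to `d + 1`. -/
theorem exists_singleBid_priceOfStability (d : ℕ) (hd : 1 ≤ d) (ε : ℝ) (hε : 0 < ε) :
      ∃ (n m : ℕ) (v : Valuations n m), d < m ∧ (∀ i, InSAW d (v i)) ∧
        ∀ π : Equiv.Perm (Fin n),
          (pureNash (singleBidAuction m π) v).Nonempty ∧
          ENNReal.ofReal ((d : ℝ) + 1 - ε / d) ≤
            priceOfStability (singleBidAuction m π) v (pureNash (singleBidAuction m π) v) ∧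
          ENNReal.ofReal ((d : ℝ) + 1 - ε / d) ≤
            priceOfStability (singleBidAuction m π) v (mixedNash (singleBidAuction m π) v) ∧
          ENNReal.ofReal ((d : ℝ) + 1 - ε / d) ≤
            priceOfStability (singleBidAuction m π) v
              (coarseCorrelated (singleBidAuction m π) v) := by
  have hd' : (0 : ℝ) < d := by exact_mod_cast hd
  -- This choice yields `(d + 1) / (1 + 4 * g) ≥ d + 1 - ε / d`.
  obtain ⟨g, hg, hgε⟩ : ∃ g : ℝ≥0, 0 < g ∧ 4 * (g : ℝ) * (d + 1) ≤ ε / d :=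
    ⟨Real.toNNReal (ε / d / (4 * (d + 1))), by simp; positivity, by
      rw [Real.coe_toNNReal _ (by positivity)]
      field_simp; exact le_rfl⟩
  have hg' : (0 : ℝ) < g := hg
  obtain ⟨K, hK⟩ := exists_nat_ge ((1 + 2 * (g : ℝ)) * (d + 1) * (1 + g) / (g ^ 3 * 2))
  rw [div_le_iff₀ (by positivity)] at hK
  -- The two extra rivals secure `2 ≤ k`, as the pure equilibrium requires.
  have hk : (1 + 2 * (g : ℝ)) * (d + 1) * (1 + g) ≤ ((K + 2 : ℕ) : ℝ) * g ^ 3 * 2 := by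
    push_cast
    nlinarith [pow_pos hg' 3]
  refine ⟨K + 2 + 1, d + 1, bundleVersusItem d (K + 2) g, Nat.lt_succ_self d,
    inSAW_bundleVersusItem, fun π => ?_⟩
  have main : ∀ μ ∈ coarseCorrelated (singleBidAuction (d + 1) π) (bundleVersusItem d (K + 2) g),
      ENNReal.ofReal ((d : ℝ) + 1 - ε / d) ≤ optWelfare (bundleVersusItem d (K + 2) g) /
        expectedWelfare (singleBidAuction (d + 1) π) (bundleVersusItem d (K + 2) g) μ := by
    intro μ hμ
    refine le_trans ?_ (ENNReal.div_le_div optWelfare_bundleVersusItem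
      (expectedWelfare_bundleVersusItem_le_of_coarse hg hk hμ))
    rw [← ENNReal.ofReal_div_of_pos (by positivity)]
    refine ENNReal.ofReal_le_ofReal ?_
    rw [le_div_iff₀ (by positivity)]
    have : 0 < ε / d := by positivity
    nlinarith
  exact ⟨⟨_, bidTheItemValue_mem_pureNash (by omega)⟩,
    le_iInf₂ fun μ hμ => main μ hμ.1, le_iInf₂ fun μ hμ => main μ hμ.1,
    le_iInf₂ fun μ hμ => main μ hμ⟩

end SingleBidEquilibrium

/-! ### SIA: from deterring prices to a Price of Anarchy bound -/

/-- At the random prices `p`, no fixed bid vector `y` is profitable in total for an agent who wants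
all of `O`, worth `V`, however the ties are broken; `W ω` are the items won in state `ω`. -/
def NoGain {Ω ι : Type*} [Fintype Ω] [DecidableEq ι] (p : Ω → ι → ℝ≥0) (O : Finset ι) (V : ℝ) :
    Prop :=
  ∀ (y : ι → ℝ≥0) (W : Ω → Finset ι), (∀ ω j, p ω j < y j → j ∈ W ω) →
    (∀ ω j, j ∈ W ω → p ω j ≤ y j) →
    ∑ ω, ((if O ⊆ W ω then V else 0) - ∑ j ∈ O ∩ W ω, (y j : ℝ)) ≤ 0

theorem NoGain.map {Ω ι κ : Type*} [Fintype Ω] [DecidableEq ι] [DecidableEq κ]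
    {p : Ω → ι → ℝ≥0} {O : Finset ι} {V : ℝ} (h : NoGain p O V) (f : ι ≃ κ) :
    NoGain (fun ω j => p ω (f.symm j)) (O.map f.toEmbedding) V := by
  intro y W h1 h2
  have := h (fun j => y (f j)) (fun ω => (W ω).map f.symm.toEmbedding)
    (fun ω j hj => by
      simp only [Finset.mem_map_equiv, Equiv.symm_symm]
      exact h1 ω (f j) (by simpa using hj))
    (fun ω j hj => by
      simp only [Finset.mem_map_equiv, Equiv.symm_symm] at hj
      simpa using h2 ω (f j) hj)
  refine le_of_eq_of_le (Finset.sum_congr rfl fun ω _ => ?_) this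
  have e1 : O.map f.toEmbedding ⊆ W ω ↔ O ⊆ (W ω).map f.symm.toEmbedding := by
    constructor
    · intro hs x hx
      simp only [Finset.mem_map_equiv, Equiv.symm_symm]
      exact hs (by simpa using hx)
    · intro hs x hx
      rw [Finset.mem_map_equiv] at hx
      simpa using hs hx
  have e2 : ∑ j ∈ O.map f.toEmbedding ∩ W ω, (y j : ℝ)
      = ∑ j ∈ O ∩ (W ω).map f.symm.toEmbedding, (y (f j) : ℝ) := by
    have : O.map f.toEmbedding ∩ W ω
        = (O ∩ (W ω).map f.symm.toEmbedding).map f.toEmbedding := by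
      ext x; simp [Finset.mem_map_equiv]
    rw [this, Finset.sum_map]; rfl
  simp only [e1, e2]

/-- Random prices that are paid by pairs of competing buyers: in state `ω` the item `j` has price
`p ω j`, and each item that is not for free belongs to the bundle `T b` of exactly one active
index `b`, for which two agents compete. -/
structure PriceScheme (Ω ι β : Type*) where
  p : Ω → ι → ℝ≥0
  T : β → Finset ι
  act : Ω → β → Prop
  exists_act : ∀ ω j, 0 < p ω j → ∃ b, act ω b ∧ j ∈ T b
  act_unique : ∀ ω b b' j, act ω b → act ω b' → j ∈ T b → j ∈ T b' → b = b'
  pos_of_act : ∀ ω b j, act ω b → j ∈ T b → 0 < p ω j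
  exists_pos : ∀ ω b, ∃ j ∈ T b, 0 < p ω j

namespace PriceScheme

variable {Ω β ρ : Type*} {n m : ℕ} (P : PriceScheme Ω (Fin m) β) (O : ρ → Finset (Fin m)) (w : ℝ)

/-- The bundle wanted by an agent: `O r`, or `T b` for each of two agents. -/
def want : ρ ⊕ β × Bool → Finset (Fin m) := Sum.elim O fun b => P.T b.1

/-- The value of the wanted bundle. -/
def worth : ρ ⊕ β × Bool → ℝ := Sum.elim (fun _ => 1) fun _ => w

/-- The valuations of all agents, numbered by `e`. -/
noncomputable def val (e : ρ ⊕ β × Bool ≃ Fin n) : Valuations n m :=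
  fun i => singleMinded (P.want O (e.symm i)) (worth w (e.symm i))

open Classical in
/-- Both agents who want an active bundle bid its prices; all other bids are zero. -/
noncomputable def bid (ω : Ω) : ρ ⊕ β × Bool → Fin m → ℝ≥0 :=
  Sum.elim (fun _ _ => 0) fun b j => if P.act ω b.1 ∧ j ∈ P.T b.1 then P.p ω j else 0

/-- The profile of all bids in state `ω`. -/
noncomputable def profile (e : ρ ⊕ β × Bool ≃ Fin n) (ω : Ω) : Fin n → Fin m → ℝ≥0 :=
  fun i => P.bid ω (e.symm i)

theorem bid_le (ω : Ω) (i : ρ ⊕ β × Bool) (j : Fin m) : P.bid ω i j ≤ P.p ω j := by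
  rcases i with r | b
  · exact zero_le
  · simp only [bid, Sum.elim_inr]; split_ifs
    · exact le_rfl
    · exact zero_le

theorem bid_inr {ω : Ω} {b : β} {j : Fin m} (h : P.act ω b) (hj : j ∈ P.T b) (c : Bool) :
    P.bid (ρ := ρ) ω (Sum.inr (b, c)) j = P.p ω j := by
  simp [bid, h, hj]

theorem bid_ne_zero {ω : Ω} {i : ρ ⊕ β × Bool} {j : Fin m} (h : P.bid ω i j ≠ 0) :
    ∃ b c, i = Sum.inr (b, c) ∧ P.act ω b ∧ j ∈ P.T b := by
  rcases i with r | ⟨b, c⟩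
  · exact absurd rfl h
  · by_cases hb : P.act ω b ∧ j ∈ P.T b
    · exact ⟨b, c, rfl, hb.1, hb.2⟩
    · simp [bid, hb] at h

variable {P} in
-- The two competitors tie at the price, so priority decides between them, the same way in every
-- state.
theorem mem_itemsWon_profile {π : Equiv.Perm (Fin n)} {e : ρ ⊕ β × Bool ≃ Fin n} {ω : Ω}
    {i : Fin n} {j : Fin m} (hp : 0 < P.p ω j) (h : j ∈ itemsWon π (P.profile e ω) i) :
    ∃ b c, i = e (Sum.inr (b, c)) ∧ P.act ω b ∧ j ∈ P.T b ∧
      π (e (Sum.inr (b, c))) < π (e (Sum.inr (b, !c))) := by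
  classical
  have h : ∀ l, l ≠ i → Precedes π (fun l => P.profile e ω l j) i l := by
    simpa [itemsWon] using h
  obtain ⟨b, hb, hj⟩ := P.exists_act ω j hp
  have hbid : P.bid ω (e.symm i) j ≠ 0 := by
    by_cases hi : i = e (Sum.inr (b, true))
    · rw [hi, Equiv.symm_apply_apply, P.bid_inr hb hj]; exact hp.ne'
    · have := (h _ (Ne.symm hi)).le
      simp only [profile, Equiv.symm_apply_apply, P.bid_inr hb hj] at this
      exact (hp.trans_le this).ne'
  obtain ⟨b', c, hi, hb', hj'⟩ := P.bid_ne_zero hbid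
  rw [Equiv.symm_apply_eq] at hi
  refine ⟨b', c, hi, hb', hj', ?_⟩
  have hne : e (Sum.inr (b', !c)) ≠ i := by rw [hi]; simp
  have := h _ hne
  rw [hi] at this
  simp only [Precedes, profile, Equiv.symm_apply_apply, P.bid_inr hb' hj'] at this
  simpa using this

theorem subset_itemsWon_profile {π : Equiv.Perm (Fin n)} {e : ρ ⊕ β × Bool ≃ Fin n} {ω : Ω}
    {b : β} {c : Bool} (hb : P.act ω b)
    (hlt : π (e (Sum.inr (b, c))) < π (e (Sum.inr (b, !c)))) :
    P.T b ⊆ itemsWon π (P.profile e ω) (e (Sum.inr (b, c))) := by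
  classical
  intro j hj
  simp only [itemsWon, Finset.mem_filter, Finset.mem_univ, true_and]
  intro l hl
  have hp := P.pos_of_act ω b j hb hj
  simp only [Precedes, profile, Equiv.symm_apply_apply, P.bid_inr hb hj]
  by_cases h0 : P.bid ω (e.symm l) j = 0
  · left; rw [h0]; exact hp
  · obtain ⟨b', c', hi, hb', hj'⟩ := P.bid_ne_zero h0
    have hbb := P.act_unique ω b' b j hb' hb hj' hj
    subst hbb
    rw [Equiv.symm_apply_eq] at hi
    have hc : c' = !c := by
      cases c <;> cases c' <;> simp_all
    right
    rw [hi, hc, Equiv.symm_apply_apply, P.bid_inr hb' hj']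
    exact ⟨rfl, hlt⟩

theorem sum_itemsWon_eq_zero {π : Equiv.Perm (Fin n)} {a : Fin n → Fin m → ℝ≥0} {i : Fin n}
    (h : a i = 0) : ∑ x ∈ itemsWon π a i, a i x = 0 := by simp [h]

variable {O w} in
-- The competitor with better priority gets all of `T b` whenever `b` is active, and `hIR` makes
-- this affordable on average. Everyone else wins only items on which they bid zero.
theorem utility_profile_nonneg [Fintype Ω] (hw : 0 ≤ w) {π : Equiv.Perm (Fin n)}
    {e : ρ ⊕ β × Bool ≃ Fin n}
    (hIR : ∀ b, 0 ≤ ∑ ω, (open Classical in if P.act ω b then w - ∑ j ∈ P.T b, (P.p ω j : ℝ) else 0))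
    (i : Fin n) :
    0 ≤ ∑ ω, (P.val O w e i ((simultaneousItemAuction m π).alloc (P.profile e ω) i)
      - ((simultaneousItemAuction m π).pay (P.profile e ω) i : ℝ)) := by
  classical
  obtain ⟨i, rfl⟩ := e.surjective i
  have hval : ∀ R, 0 ≤ P.val O w e (e i) R := fun R => by
    refine singleMinded_nonneg _ ?_ _
    rw [Equiv.symm_apply_apply]
    rcases i with r | b
    · exact zero_le_one
    · exact hw
  have hpay0 : ∀ ω, P.bid ω i = 0 →
      ((simultaneousItemAuction m π).pay (P.profile e ω) (e i) : ℝ) = 0 := by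
    intro ω h
    have : P.profile e ω (e i) = 0 := by rw [profile, Equiv.symm_apply_apply, h]
    have h2 : (simultaneousItemAuction m π).pay (P.profile e ω) (e i) = 0 :=
      sum_itemsWon_eq_zero this
    rw [h2]; rfl
  rcases i with r | ⟨b, c⟩
  · refine Finset.sum_nonneg fun ω _ => ?_
    rw [hpay0 ω rfl, sub_zero]
    exact hval _
  · by_cases hlt : π (e (Sum.inr (b, c))) < π (e (Sum.inr (b, !c)))
    · refine (hIR b).trans (Finset.sum_le_sum fun ω _ => ?_)
      split_ifs with hb
      · have hsub := P.subset_itemsWon_profile hb hlt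
        refine sub_le_sub (le_of_eq ?_) ?_
        · rw [val, Equiv.symm_apply_apply]
          exact (if_pos hsub).symm
        · have : (simultaneousItemAuction m π).pay (P.profile e ω) (e (Sum.inr (b, c)))
            = ∑ x ∈ itemsWon π (P.profile e ω) (e (Sum.inr (b, c))),
                P.profile e ω (e (Sum.inr (b, c))) x := rfl
          rw [this, NNReal.coe_sum, ← Finset.sum_subset hsub]
          · refine Finset.sum_le_sum fun x _ => ?_
            exact_mod_cast P.bid_le _ _ _
          · intro x _ hx
            rw [profile, Equiv.symm_apply_apply]
            simp [bid, hx]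
      · rw [hpay0 ω (by funext j; simp [bid, hb]), sub_zero]
        exact hval _
    · refine Finset.sum_nonneg fun ω _ => ?_
      have : (simultaneousItemAuction m π).pay (P.profile e ω) (e (Sum.inr (b, c))) = 0 := by
        change ∑ x ∈ itemsWon π (P.profile e ω) (e (Sum.inr (b, c))),
          P.profile e ω (e (Sum.inr (b, c))) x = 0
        refine Finset.sum_eq_zero fun x hx => ?_
        rw [profile, Equiv.symm_apply_apply]
        by_contra hne
        have hp : 0 < P.p ω x := (pos_iff_ne_zero.2 hne).trans_le (P.bid_le _ _ _)
        obtain ⟨b', c', hi, -, -, hlt'⟩ := mem_itemsWon_profile hp hx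
        have hi := e.injective hi
        simp only [Sum.inr.injEq, Prod.mk.injEq] at hi
        rw [← hi.1, ← hi.2] at hlt'
        exact hlt hlt'
      rw [this, NNReal.coe_zero, sub_zero]
      exact hval _

variable {O w} in
-- A deviator faces exactly the prices `P.p`: no opposing bid exceeds them, and each positive price
-- is also bid by a competitor other than the deviator. Payments outside the wanted bundle only
-- hurt.
theorem utility_update_nonpos [Fintype Ω] {π : Equiv.Perm (Fin n)} {e : ρ ⊕ β × Bool ≃ Fin n}
    (hO : ∀ r, NoGain P.p (O r) 1) (hT : ∀ b, NoGain P.p (P.T b) w)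
    (i : Fin n) (y : Fin m → ℝ≥0) :
    ∑ ω, (P.val O w e i
        ((simultaneousItemAuction m π).alloc (Function.update (P.profile e ω) i y) i)
      - ((simultaneousItemAuction m π).pay (Function.update (P.profile e ω) i y) i : ℝ)) ≤ 0 := by
  classical
  obtain ⟨i, rfl⟩ := e.surjective i
  have hNG : NoGain P.p (P.want O i) (worth w i) := by
    rcases i with r | b
    · exact hO r
    · exact hT b.1
  have hW : ∀ ω j, j ∈ itemsWon π (Function.update (P.profile e ω) (e i) y) (e i) ↔
      ∀ l, l ≠ e i → P.profile e ω l j < y j ∨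
        (y j = P.profile e ω l j ∧ π (e i) < π l) := by
    intro ω j
    simp only [itemsWon, Finset.mem_filter, Finset.mem_univ, true_and, Precedes,
      Function.update_self]
    refine forall₂_congr fun l hl => ?_
    rw [Function.update_of_ne hl]
  refine le_trans (Finset.sum_le_sum fun ω _ => ?_) (hNG y
    (fun ω => itemsWon π (Function.update (P.profile e ω) (e i) y) (e i)) ?_ ?_)
  · refine sub_le_sub ?_ ?_
    · rw [val, Equiv.symm_apply_apply]
      exact le_rfl
    · have : (simultaneousItemAuction m π).pay (Function.update (P.profile e ω) (e i) y) (e i)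
          = ∑ x ∈ itemsWon π (Function.update (P.profile e ω) (e i) y) (e i),
            Function.update (P.profile e ω) (e i) y (e i) x := rfl
      rw [this, Function.update_self, NNReal.coe_sum]
      exact Finset.sum_le_sum_of_subset_of_nonneg Finset.inter_subset_right
        fun _ _ _ => NNReal.coe_nonneg _
  · intro ω j hj
    rw [hW]
    exact fun l _ => Or.inl ((P.bid_le _ _ _).trans_lt hj)
  · intro ω j hj
    rw [hW] at hj
    by_cases hp : P.p ω j = 0
    · rw [hp]; exact zero_le
    obtain ⟨b, hb, hjb⟩ := P.exists_act ω j (pos_iff_ne_zero.2 hp)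
    obtain ⟨c, hc⟩ : ∃ c, e (Sum.inr (b, c)) ≠ e i := by
      by_contra! h
      have := (h true).trans (h false).symm
      simp at this
    have := hj _ hc
    simp only [profile, Equiv.symm_apply_apply, P.bid_inr hb hjb] at this
    rcases this with h | h
    · exact h.le
    · exact h.1.ge

variable {O w} in
theorem uniformLaw_profile_mem [Fintype Ω] [Nonempty Ω] (hw : 0 ≤ w) (π : Equiv.Perm (Fin n))
    (e : ρ ⊕ β × Bool ≃ Fin n)
    (hIR : ∀ b, 0 ≤ ∑ ω, (open Classical in if P.act ω b then w - ∑ j ∈ P.T b, (P.p ω j : ℝ) else 0))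
    (hO : ∀ r, NoGain P.p (O r) 1) (hT : ∀ b, NoGain P.p (P.T b) w) :
    uniformLaw (X := Fin n → (simultaneousItemAuction m π).Action) (P.profile e)
      ∈ coarseCorrelated (simultaneousItemAuction m π) (P.val O w e) := by
  refine uniformLaw_mem_coarseCorrelated ?_ _ fun i y =>
    (P.utility_update_nonpos hO hT i y).trans (P.utility_profile_nonneg hw hIR i)
  intro i R
  refine singleMinded_nonneg _ ?_ _
  rcases e.symm i with r | b
  · exact zero_le_one
  · exact hw

variable {O w} in
-- Positively priced items go only to agents of active bundles. Rows and inactive bundles always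
-- contain such an item, so they are worth nothing to their agents; of two competitors at most one
-- gets the bundle.
theorem sum_val_profile_le [Fintype ρ] [Fintype β] (π : Equiv.Perm (Fin n))
    (e : ρ ⊕ β × Bool ≃ Fin n) (ω : Ω) (hrow : ∀ r, ∃ j ∈ O r, 0 < P.p ω j) {A : ℕ}
    (hA : (open Classical in Finset.univ.filter (P.act ω)).card ≤ A) :
    ∑ i, ENNReal.ofReal (P.val O w e i
      ((simultaneousItemAuction m π).alloc (P.profile e ω) i)) ≤ ENNReal.ofReal (A * w) := by
  classical
  rw [← Equiv.sum_comp e, Fintype.sum_sum_type, Fintype.sum_prod_type]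
  have halloc : ∀ i, (simultaneousItemAuction m π).alloc (P.profile e ω) i
    = itemsWon π (P.profile e ω) i := fun _ => rfl
  have h1 : ∀ r : ρ, ENNReal.ofReal (P.val O w e (e (Sum.inl r))
      ((simultaneousItemAuction m π).alloc (P.profile e ω) (e (Sum.inl r)))) = 0 := by
    intro r
    rw [val, Equiv.symm_apply_apply, singleMinded, if_neg, ENNReal.ofReal_zero]
    intro hs
    obtain ⟨j, hj, hp⟩ := hrow r
    obtain ⟨b, c, hi, -⟩ := mem_itemsWon_profile hp (hs hj)
    simpa using e.injective hi
  have h2 : ∀ b : β, ∑ c, ENNReal.ofReal (P.val O w e (e (Sum.inr (b, c)))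
      ((simultaneousItemAuction m π).alloc (P.profile e ω) (e (Sum.inr (b, c)))))
      ≤ if P.act ω b then ENNReal.ofReal w else 0 := by
    intro b
    obtain ⟨j, hj, hp⟩ := P.exists_pos ω b
    have key : ∀ c, ENNReal.ofReal (P.val O w e (e (Sum.inr (b, c)))
      ((simultaneousItemAuction m π).alloc (P.profile e ω) (e (Sum.inr (b, c)))))
      ≤ if P.act ω b ∧ π (e (Sum.inr (b, c))) < π (e (Sum.inr (b, !c)))
        then ENNReal.ofReal w else 0 := by
      intro c
      rw [val, Equiv.symm_apply_apply, singleMinded, halloc]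
      by_cases hs : P.want O (Sum.inr (b, c)) ⊆ itemsWon π (P.profile e ω) (e (Sum.inr (b, c)))
      · obtain ⟨b', c', hi, hb, -, hlt⟩ := mem_itemsWon_profile hp (hs hj)
        have hi := e.injective hi
        simp only [Sum.inr.injEq, Prod.mk.injEq] at hi
        obtain ⟨rfl, rfl⟩ := hi
        rw [if_pos hs, if_pos ⟨hb, hlt⟩]
        exact le_rfl
      · rw [if_neg hs, ENNReal.ofReal_zero]
        exact zero_le
    refine (Finset.sum_le_sum fun c _ => key c).trans ?_
    rw [Fintype.sum_bool]
    by_cases hb : P.act ω b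
    · simp only [hb, true_and, if_true, Bool.not_true, Bool.not_false]
      split_ifs with h h'
      · exact absurd h h'.not_gt
      all_goals simp
    · simp [hb]
  calc _ ≤ (0 : ℝ≥0∞) + ∑ b : β, (if P.act ω b then ENNReal.ofReal w else 0) :=
        add_le_add (le_of_eq (Finset.sum_eq_zero fun r _ => h1 r))
          (Finset.sum_le_sum fun b _ => h2 b)
    _ = ((Finset.univ.filter (P.act ω)).card : ℝ≥0∞) * ENNReal.ofReal w := by
        rw [zero_add, ← Finset.sum_filter, Finset.sum_const, nsmul_eq_mul]
    _ ≤ (A : ℝ≥0∞) * ENNReal.ofReal w := by gcongr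
    _ = _ := by rw [ENNReal.ofReal_mul (by positivity), ENNReal.ofReal_natCast]

variable {O w} in
theorem card_le_optWelfare [Fintype ρ] [Fintype β] (e : ρ ⊕ β × Bool ≃ Fin n)
    (hdisj : ∀ r r', r ≠ r' → Disjoint (O r) (O r')) :
    ENNReal.ofReal (Fintype.card ρ) ≤ optWelfare (P.val O w e) := by
  classical
  unfold optWelfare
  refine le_trans ?_ (le_iSup₂ (f := fun (A : Fin n → Finset (Fin m))
    (_ : A ∈ {A : Fin n → Finset (Fin m) |
      Pairwise (fun i j => Disjoint (A i) (A j))}) =>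
    ∑ i, ENNReal.ofReal (P.val O w e i (A i)))
    (fun i => Sum.elim O (fun _ => ∅) (e.symm i)) ?_)
  · rw [← Equiv.sum_comp e, Fintype.sum_sum_type]
    refine le_trans (le_of_eq ?_) le_self_add
    simp [val, singleMinded, want, worth]
  · intro i j hij
    have hij' : e.symm i ≠ e.symm j := fun h => hij (e.symm.injective h)
    dsimp only
    rcases hi : e.symm i with r | b <;> rcases hj : e.symm j with r' | b' <;> simp
    refine hdisj r r' ?_
    rintro rfl
    exact hij' (hi.trans hj.symm)

variable {O w} in
theorem le_priceOfAnarchy [Fintype Ω] [Nonempty Ω] [Fintype ρ] [Fintype β] (hw : 0 < w)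
    (π : Equiv.Perm (Fin n)) (e : ρ ⊕ β × Bool ≃ Fin n)
    (hIR : ∀ b, 0 ≤ ∑ ω, (open Classical in if P.act ω b then w - ∑ j ∈ P.T b, (P.p ω j : ℝ) else 0))
    (hO : ∀ r, NoGain P.p (O r) 1) (hT : ∀ b, NoGain P.p (P.T b) w)
    (hdisj : ∀ r r', r ≠ r' → Disjoint (O r) (O r'))
    (hrow : ∀ ω r, ∃ j ∈ O r, 0 < P.p ω j) {A : ℕ} (hApos : 0 < A)
    (hA : ∀ ω, (open Classical in Finset.univ.filter (P.act ω)).card ≤ A) :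
    ENNReal.ofReal (Fintype.card ρ / (A * w))
      ≤ priceOfAnarchy (simultaneousItemAuction m π) (P.val O w e)
          (coarseCorrelated (simultaneousItemAuction m π) (P.val O w e)) := by
  have hApos' : (0 : ℝ) < A := by exact_mod_cast hApos
  unfold priceOfAnarchy
  refine le_trans ?_ (le_iSup₂ (f := fun (μ : Measure _) (_ : μ ∈ coarseCorrelated
      (simultaneousItemAuction m π) (P.val O w e)) => optWelfare (P.val O w e) /
        expectedWelfare (simultaneousItemAuction m π) (P.val O w e) μ) _
    (P.uniformLaw_profile_mem hw.le π e hIR hO hT))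
  rw [ENNReal.ofReal_div_of_pos (by positivity)]
  refine ENNReal.div_le_div (P.card_le_optWelfare e hdisj) ?_
  refine (lintegral_uniformLaw (X := Fin n → (simultaneousItemAuction m π).Action)
    (P.profile e) _).trans_le ?_
  calc _ ≤ (Fintype.card Ω : ℝ≥0∞)⁻¹ * ∑ _ : Ω, ENNReal.ofReal (A * w) := by
        gcongr with ω
        exact P.sum_val_profile_le π e ω (hrow ω) (hA ω)
    _ = ENNReal.ofReal (A * w) := by
        rw [Finset.sum_const, Finset.card_univ, nsmul_eq_mul, ← mul_assoc,
          ENNReal.inv_mul_cancel (by simp) (by simp), one_mul]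

/-- Renaming the items. -/
def map {ι κ : Type*} (Q : PriceScheme Ω ι β) (f : ι ≃ κ) : PriceScheme Ω κ β where
  p ω j := Q.p ω (f.symm j)
  T b := (Q.T b).map f.toEmbedding
  act := Q.act
  exists_act ω j h := by
    simpa [Finset.mem_map_equiv] using Q.exists_act ω _ h
  act_unique ω b b' j h h' hj hj' := by
    rw [Finset.mem_map_equiv] at hj hj'
    exact Q.act_unique ω b b' _ h h' hj hj'
  pos_of_act ω b j h hj := by
    rw [Finset.mem_map_equiv] at hj
    exact Q.pos_of_act ω b _ h hj
  exists_pos ω b := by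
    obtain ⟨j, hj, hp⟩ := Q.exists_pos ω b
    exact ⟨f j, by simpa using hj, by simpa using hp⟩

/-- A price scheme whose prices deter everyone yields a lower bound on the price of anarchy. -/
theorem exists_le_priceOfAnarchy {ι : Type*} [Fintype ι] [DecidableEq ι] [Fintype Ω] [Nonempty Ω]
    [Fintype ρ] [Fintype β] (Q : PriceScheme Ω ι β) {O : ρ → Finset ι} {w : ℝ} {d : ℕ}
    (hw : 0 < w) (hd : d < Fintype.card ι) (hcardT : ∀ b, (Q.T b).card ≤ d + 1)
    (hcardO : ∀ r, (O r).card ≤ d + 1)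
    (hIR : ∀ b, 0 ≤ ∑ ω, (open Classical in if Q.act ω b then w - ∑ j ∈ Q.T b, (Q.p ω j : ℝ) else 0))
    (hO : ∀ r, NoGain Q.p (O r) 1) (hT : ∀ b, NoGain Q.p (Q.T b) w)
    (hdisj : ∀ r r', r ≠ r' → Disjoint (O r) (O r'))
    (hrow : ∀ ω r, ∃ j ∈ O r, 0 < Q.p ω j) {A : ℕ} (hApos : 0 < A)
    (hA : ∀ ω, (open Classical in Finset.univ.filter (Q.act ω)).card ≤ A) :
    ∃ (n m : ℕ) (v : Valuations n m), d < m ∧ (∀ i, InSAW d (v i)) ∧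
        ∀ π : Equiv.Perm (Fin n),
          ENNReal.ofReal (Fintype.card ρ / (A * w)) ≤
            priceOfAnarchy (simultaneousItemAuction m π) v
              (coarseCorrelated (simultaneousItemAuction m π) v) := by
  set f := Fintype.equivFin ι
  set e := Fintype.equivFin (ρ ⊕ β × Bool)
  have ω₀ : Ω := Classical.arbitrary Ω
  refine ⟨_, _, (Q.map f).val (fun r => (O r).map f.toEmbedding) w e, hd, fun i => ?_,
    fun π => (Q.map f).le_priceOfAnarchy hw π e ?_ ?_ ?_ ?_ ?_ hApos hA⟩
  · unfold val
    rcases e.symm i with r | b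
    · obtain ⟨j, hj, -⟩ := hrow ω₀ r
      exact inSAW_singleMinded ⟨f j, by simpa [want] using hj⟩ (by simpa [want] using hcardO r)
        zero_le_one
    · obtain ⟨j, hj, -⟩ := Q.exists_pos ω₀ b.1
      exact inSAW_singleMinded ⟨f j, by simpa [want, map] using hj⟩
        (by simpa [want, map] using hcardT b.1) hw.le
  · intro b
    refine (hIR b).trans_eq (Finset.sum_congr rfl fun ω _ => ?_)
    simp only [map, Finset.sum_map, Equiv.coe_toEmbedding, Equiv.symm_apply_apply]
    rfl
  · exact fun r => (hO r).map f
  · exact fun b => (hT b).map f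
  · exact fun r r' h => (Finset.disjoint_map _).2 (hdisj r r' h)
  · intro ω r
    obtain ⟨j, hj, hp⟩ := hrow ω r
    exact ⟨f j, by simpa using hj, by simpa [map] using hp⟩

end PriceScheme

/-! ### SIA with `d = 1`: two triangles -/

/-- If both bids reach `1 / 2`, each win of the bundle costs at least 1. If only one does, the
bundle can be won only in the state where the other item is free; the higher bid is paid there and
again where its own item is free, at least 1 in total. -/
theorem noGain_pair {ι : Type*} [DecidableEq ι] {p : Fin 3 → ι → ℝ≥0} {a b : ι} (hab : a ≠ b)
    (ω : Fin 3 → Fin 3) (hω : ω.Injective) (h0a : p (ω 0) a = 0) (h0b : p (ω 0) b = 1 / 2)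
    (h1a : p (ω 1) a = 1 / 2) (h1b : p (ω 1) b = 0) (h2a : p (ω 2) a = 1 / 2)
    (h2b : p (ω 2) b = 1 / 2) : NoGain p {a, b} 1 := by
  intro y W hlt hle
  have hsum : ∀ f : Fin 3 → ℝ, ∑ i, f i = f (ω 0) + f (ω 1) + f (ω 2) := by
    intro f
    rw [← Equiv.sum_comp (Equiv.ofBijective ω (Finite.injective_iff_bijective.1 hω)),
      Fin.sum_univ_three]
    rfl
  have hterm : ∀ i, ∑ j ∈ ({a, b} : Finset ι) ∩ W i, (y j : ℝ)
      = (if a ∈ W i then (y a : ℝ) else 0) + if b ∈ W i then (y b : ℝ) else 0 := by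
    intro i
    rw [← Finset.sum_ite_mem, Finset.sum_pair hab]
  have hlt' : ∀ {i j} {q : ℝ≥0}, p i j = q → j ∉ W i → (y j : ℝ) ≤ q := by
    intro i j q hq hj
    rw [← hq]
    exact_mod_cast not_lt.1 fun h => hj (hlt i j h)
  have hle' : ∀ {i j} {q : ℝ≥0}, p i j = q → j ∈ W i → (q : ℝ) ≤ y j := by
    intro i j q hq hj
    rw [← hq]
    exact_mod_cast hle i j hj
  have L0a := hlt' h0a; have L1a := hlt' h1a; have L2a := hlt' h2a
  have L0b := hlt' h0b; have L1b := hlt' h1b; have L2b := hlt' h2b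
  have G0b := hle' h0b; have G1a := hle' h1a; have G2a := hle' h2a; have G2b := hle' h2b
  have ya : (0 : ℝ) ≤ y a := NNReal.coe_nonneg _
  have yb : (0 : ℝ) ≤ y b := NNReal.coe_nonneg _
  push_cast at L0a L1a L2a L0b L1b L2b G0b G1a G2a G2b
  rw [hsum]
  simp only [hterm, Finset.insert_subset_iff, Finset.singleton_subset_iff]
  by_cases A0 : a ∈ W (ω 0) <;> by_cases A1 : a ∈ W (ω 1) <;> by_cases A2 : a ∈ W (ω 2) <;>
  by_cases B0 : b ∈ W (ω 0) <;> by_cases B1 : b ∈ W (ω 1) <;> by_cases B2 : b ∈ W (ω 2) <;>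
  simp only [A0, A1, A2, B0, B1, B2, not_true_eq_false, not_false_eq_true, forall_const,
    if_true, if_false, and_false, and_true, IsEmpty.forall_iff] at * <;> linarith

/-- In each of two copies of a triangle, all items but a random one have price `1 / 2`. -/
noncomputable def trianglePrices : PriceScheme (Fin 3) (Bool × Fin 3) (Bool × Fin 3) where
  -- The shift in one copy ensures that no row `{(false, r), (true, r)}` is ever entirely free.
  p ω j := if j.2 = ω + (if j.1 then 1 else 0) then 0 else 1 / 2
  T b := Finset.univ.filter fun j => j.1 = b.1 ∧ j.2 ≠ b.2
  act ω b := b.2 = ω + (if b.1 then 1 else 0)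
  exists_act ω j h := by
    refine ⟨(j.1, ω + (if j.1 then 1 else 0)), rfl, ?_⟩
    simp only [Finset.mem_filter, Finset.mem_univ, true_and]
    intro hj
    simp [hj] at h
  act_unique ω b b' j h h' hj hj' := by
    simp only [Finset.mem_filter, Finset.mem_univ, true_and] at hj hj'
    have : b.1 = b'.1 := hj.1.symm.trans hj'.1
    refine Prod.ext this ?_
    rw [h, h', this]
  pos_of_act ω b j h hj := by
    simp only [Finset.mem_filter, Finset.mem_univ, true_and] at hj
    rw [if_neg (by rw [hj.1, ← h]; exact hj.2)]
    norm_num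
  exists_pos ω b := by
    obtain ⟨x, i⟩ := b
    have : ∃ j : Fin 3, j ≠ i ∧ j ≠ ω + (if x then 1 else 0) := by
      revert x i ω; decide
    obtain ⟨j, hj, hj'⟩ := this
    refine ⟨(x, j), by simpa using hj, ?_⟩
    simp [hj']

theorem card_trianglePrices_T (b : Bool × Fin 3) : (trianglePrices.T b).card ≤ 2 := by
  change (Finset.univ.filter fun j : Bool × Fin 3 => j.1 = b.1 ∧ j.2 ≠ b.2).card ≤ 2
  revert b; decide

/-- The price of anarchy bound for `d = 1`. -/
theorem exists_priceOfAnarchy_three_halves :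
    ∃ (n m : ℕ) (v : Valuations n m), 1 < m ∧ (∀ i, InSAW 1 (v i)) ∧
      ∀ π : Equiv.Perm (Fin n), ENNReal.ofReal (3 / 2) ≤
        priceOfAnarchy (simultaneousItemAuction m π) v
          (coarseCorrelated (simultaneousItemAuction m π) v) := by
  have hT : ∀ b, NoGain trianglePrices.p (trianglePrices.T b) 1 := by
    rintro ⟨x, i⟩
    have hT : trianglePrices.T (x, i) = {(x, i + 1), (x, i + 2)} := by
      change Finset.univ.filter _ = _
      revert x i; decide
    have h1 : ∀ i : Fin 3, i + 1 ≠ i + 2 := by decide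
    have h2 : ∀ i : Fin 3, i + 1 ≠ i ∧ i + 2 ≠ i ∧ i + 2 ≠ i + 1 := by decide
    rw [hT]
    have hinj : ∀ (s i : Fin 3), (![i + 1 - s, i + 2 - s, i - s] : Fin 3 → Fin 3).Injective := by
      decide
    refine noGain_pair (by simp [h1]) ![i + 1 - (if x then 1 else 0), i + 2 - (if x then 1 else 0),
      i - (if x then 1 else 0)] (hinj _ i) ?_ ?_ ?_ ?_ ?_ ?_ <;>
    simp [trianglePrices, h1, h2]
  have hO : ∀ r : Fin 3, NoGain trianglePrices.p {(false, r), (true, r)} 1 := by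
    intro r
    have h1 : ∀ r : Fin 3, r ≠ r - 1 ∧ r ≠ r + 1 ∧ r ≠ r + 1 + 1 := by decide
    have hinj : ∀ (i : Fin 3), (![i, i - 1, i + 1] : Fin 3 → Fin 3).Injective := by
      decide
    refine noGain_pair (by simp) ![r, r - 1, r + 1] (hinj r) ?_ ?_ ?_ ?_ ?_ ?_ <;>
    simp [trianglePrices, h1]
  -- Three rows of value 1 stand against two active bundles of value 1, one per copy.
  have key := trianglePrices.exists_le_priceOfAnarchy (d := 1) (w := 1) (A := 2) one_pos
    (by simp) ?_ ?_ ?_ hO hT ?_ ?_ two_pos ?_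
  · simpa using key
  · exact card_trianglePrices_T
  · exact fun r => Finset.card_le_two
  · intro b
    refine Finset.sum_nonneg fun ω _ => ?_
    split_ifs
    · have hle : ∀ j, (trianglePrices.p ω j : ℝ) ≤ 1 / 2 := by
        intro j
        simp only [trianglePrices]
        split_ifs <;> simp
      have := Finset.sum_le_card_nsmul _ _ _ fun j (_ : j ∈ trianglePrices.T b) => hle j
      have hc' : ((trianglePrices.T b).card : ℝ) ≤ 2 := by
        exact_mod_cast card_trianglePrices_T b
      rw [nsmul_eq_mul] at this
      linarith
    · exact le_rfl
  · intro r r' h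
    simp [h.symm]
  · intro ω r
    by_cases h : r = ω
    · refine ⟨(true, r), by simp, ?_⟩
      subst h
      simp [trianglePrices]
    · refine ⟨(false, r), by simp, ?_⟩
      simp [trianglePrices, h]
  · intro ω
    have : ∀ ω : Fin 3, (Finset.univ.filter fun b : Bool × Fin 3 =>
        b.2 = ω + (if b.1 then 1 else 0)).card ≤ 2 := by decide
    convert this ω
    rfl

/-! ### SIA with `d ≥ 2`: inequalities for bids and price levels -/

/-- With `t = (l + 1) / L`, the hypothesis reads `t * (1 - y) ≤ c * y`, and at most `L * t` levels
lie at or below the largest `l` in `S`. -/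
theorem card_mul_one_sub_le {L : ℕ} {c y : ℝ} (hc : 0 ≤ c) (hy : 0 ≤ y)
    {S : Finset (Fin L)}
    (hS : ∀ l ∈ S, (((l : ℕ) + 1) / L : ℝ) / (c + ((l : ℕ) + 1) / L) ≤ y) :
    (S.card : ℝ) * (1 - y) ≤ L * (c * y) := by
  rcases S.eq_empty_or_nonempty with rfl | hne
  · simp only [Finset.card_empty, Nat.cast_zero, zero_mul]; positivity
  rcases le_or_gt 1 y with h1 | h1
  · exact (mul_nonpos_of_nonneg_of_nonpos (by positivity) (by linarith)).trans (by positivity)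
  set M := S.max' hne
  have hcard : S.card ≤ (M : ℕ) + 1 := by
    have : S ⊆ Finset.Iic M := fun l hl => Finset.mem_Iic.2 (S.le_max' l hl)
    simpa using Finset.card_le_card this
  have hcard' : (S.card : ℝ) ≤ (M : ℕ) + 1 := by exact_mod_cast hcard
  have hL : (0 : ℝ) < L := by exact_mod_cast M.pos
  have hM := hS M (S.max'_mem hne)
  set t := (((M : ℕ) + 1) / L : ℝ) with ht
  have htpos : 0 < t := by positivity
  rw [div_le_iff₀ (by positivity)] at hM
  have e : ((M : ℕ) + 1 : ℝ) = L * t := by rw [ht]; field_simp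
  calc (S.card : ℝ) * (1 - y) ≤ (L * t) * (1 - y) := by
        rw [← e]; exact mul_le_mul_of_nonneg_right hcard' (by linarith)
    _ = L * (t * (1 - y)) := by ring
    _ ≤ L * (c * y) := mul_le_mul_of_nonneg_left (by nlinarith) hL.le

/-- Concavity of `t ↦ t / (c + t)`; it bounds average prices by the price at `t = 1 / 2`. -/
theorem div_add_self_le_tangent {c s t : ℝ} (hc : 0 ≤ c) (hs : 0 < s) (ht : 0 < t) :
    t / (c + t) ≤ s / (c + s) + c / (c + s) ^ 2 * (t - s) := by
  have h1 : 0 < c + s := by positivity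
  have h2 : 0 < c + t := by positivity
  have : s / (c + s) + c / (c + s) ^ 2 * (t - s) - t / (c + t)
      = c * (t - s) ^ 2 / ((c + s) ^ 2 * (c + t)) := by
    field_simp; ring
  have h3 : 0 ≤ c * (t - s) ^ 2 / ((c + s) ^ 2 * (c + t)) := by positivity
  linarith

theorem sum_fin_add_one_div_sub_half {L : ℕ} (hL : 0 < L) :
    ∑ l : Fin L, ((((l : ℕ) + 1) / L : ℝ) - 1 / 2) = 1 / 2 := by
  have h : ∀ n : ℕ, ∑ l ∈ Finset.range n, ((l : ℝ) + 1) = n * (n + 1) / 2 := by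
    intro n
    induction n with
    | zero => simp
    | succ n ih => rw [Finset.sum_range_succ, ih]; push_cast; ring
  have hL' : (0 : ℝ) < L := by exact_mod_cast hL
  rw [Fin.sum_univ_eq_sum_range fun l => (((l : ℝ) + 1) / L : ℝ) - 1 / 2,
    Finset.sum_sub_distrib, ← Finset.sum_div, h]
  simp
  field_simp
  ring

/-- The utility in a state in which only the item `j₀` of the bundle `O` is not for free. -/
theorem utility_le_of_unique_price {ι : Type*} [DecidableEq ι] {p y : ι → ℝ≥0} {O W : Finset ι}
    {V : ℝ} (hV : 0 ≤ V) {j₀ : ι} (hj₀ : j₀ ∈ O) (hp : ∀ j ∈ O, j ≠ j₀ → p j = 0)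
    (hW : ∀ j, p j < y j → j ∈ W) :
    (if O ⊆ W then V else 0) - ∑ j ∈ O ∩ W, (y j : ℝ)
      ≤ (if j₀ ∈ W then V - y j₀ else 0) + (y j₀ - ∑ j ∈ O, (y j : ℝ)) := by
  -- A free item is won as soon as its bid is positive, so its bid is paid in any case.
  have h1 : ∑ j ∈ O ∩ W, (y j : ℝ) = (if j₀ ∈ W then (y j₀ : ℝ) else 0)
      + ∑ j ∈ O.erase j₀, (y j : ℝ) := by
    rw [← Finset.sum_ite_mem, ← Finset.add_sum_erase _ _ hj₀]
    congr 1
    refine Finset.sum_congr rfl fun j hj => ?_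
    rw [Finset.mem_erase] at hj
    split_ifs with h
    · rfl
    · have := not_lt.1 fun hlt => h (hW j hlt)
      rw [hp j hj.2 hj.1] at this
      have : y j = 0 := le_antisymm this zero_le
      simp [this]
  have h2 := Finset.add_sum_erase O (fun j => (y j : ℝ)) hj₀
  rw [h1]
  by_cases h : j₀ ∈ W
  · simp only [h, if_true]
    split_ifs <;> linarith
  · have : ¬ O ⊆ W := fun hs => h (hs hj₀)
    simp only [h, this, if_false]
    linarith

/-- Doubling the slope pays for the bonus `η`. For `y ≤ 1 - η` one has `1 + η - y ≤ 2 * (1 - y)`;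
for `y` between `1 - η` and `1 + η` the bound `n ≤ L` suffices, since `hη1` says `1 + η ≤ (k - 1) *
(1 - η)`. -/
theorem mul_sub_le_of_steep {k η L n y : ℝ} (hη1 : k * η ≤ k - 2) (hk : 3 ≤ k)
    (hL : n ≤ L) (hn : 0 ≤ n) (hy : 0 ≤ y)
    (h : n * (1 - y) ≤ L * ((k - 2) / 2 * y)) : n * (1 + η - y) ≤ L * ((k - 2) * y) := by
  have hL0 : 0 ≤ L := hn.trans hL
  rcases le_or_gt (1 + η) y with h1 | h1
  · exact (mul_nonpos_of_nonneg_of_nonpos hn (by linarith)).trans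
      (mul_nonneg hL0 (mul_nonneg (by linarith) hy))
  rcases le_or_gt y (1 - η) with h2 | h2
  · have : n * η ≤ n * (1 - y) := mul_le_mul_of_nonneg_left (by linarith) hn
    linarith
  · calc n * (1 + η - y) ≤ L * (1 + η - y) := mul_le_mul_of_nonneg_right hL (by linarith)
      _ ≤ L * ((k - 2) * y) := mul_le_mul_of_nonneg_left (by nlinarith) hL0

/-- The total utility from a bid vector for a bundle one of whose items is not for free in most
states (`y u` and `z` are the bids). -/
theorem sum_utility_le_zero {α : Type*} (I : Finset α) {k η L N z : ℝ} {n y : α → ℝ}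
    (hk : 3 ≤ k) (hI : (I.card : ℝ) = k - 1) (hη : 0 < η) (hη1 : k * η ≤ k - 2)
    (hη2 : k * η ≤ (k - 1) * (1 - η)) (hη3 : η < 1)
    (hnL : ∀ u ∈ I, n u ≤ L) (hn : ∀ u ∈ I, 0 ≤ n u) (hN : 0 ≤ N)
    (hy : ∀ u ∈ I, 0 ≤ y u) (hL : 0 ≤ L)
    (h : ∀ u ∈ I, n u * (1 - y u) ≤ L * ((k - 2) / 2 * y u))
    (hN' : ∀ u ∈ I, N * (1 - y u) ≤ L * ((k - 2) / 2 * y u))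
    (hNz : N * (1 - z) ≤ L * ((k - 1) * z)) :
    ∑ u ∈ I, (n u * (1 + η - y u) + L * (y u - (z + ∑ u ∈ I, y u)))
      + N * (1 + η - (z + ∑ u ∈ I, y u)) ≤ 0 := by
  set Y := ∑ u ∈ I, y u with hY
  have hY0 : 0 ≤ Y := Finset.sum_nonneg hy
  have e1 : ∑ u ∈ I, (n u * (1 + η - y u) + L * (y u - (z + Y)))
      = ∑ u ∈ I, n u * (1 + η - y u) + L * (Y - (k - 1) * (z + Y)) := by
    rw [Finset.sum_add_distrib, ← Finset.mul_sum, Finset.sum_sub_distrib, ← hY, Finset.sum_const,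
      nsmul_eq_mul, hI]
  rw [e1]
  have e2 : ∑ u ∈ I, n u * (1 + η - y u) ≤ L * ((k - 2) * Y) := by
    rw [hY, Finset.mul_sum, Finset.mul_sum]
    exact Finset.sum_le_sum fun u hu =>
      mul_sub_le_of_steep hη1 hk (hnL u hu) (hn u hu) (hy u hu) (h u hu)
  -- For `Y ≥ η` the bids counted in `Y` absorb the bonus of the `N` term, and `e2` suffices. For `Y
  -- < η` every `y u` is below `η`, so few levels are won: only `B + η * X` of the budget `2 * B` is
  -- used, and the remaining `B` must cover `η * (X + N)`.
  rcases le_or_gt η Y with hc | hc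
  · have : N * (η - Y) ≤ 0 := mul_nonpos_of_nonneg_of_nonpos hN (by linarith)
    linarith
  · set B := L * ((k - 2) / 2 * Y) with hB
    have hB0 : 0 ≤ B := mul_nonneg hL (mul_nonneg (by linarith) hY0)
    set X := ∑ u ∈ I, n u with hX
    have hyη : ∀ u ∈ I, 1 - η ≤ 1 - y u := by
      intro u hu
      have := Finset.single_le_sum hy hu
      linarith
    have hsumB : ∑ u ∈ I, L * ((k - 2) / 2 * y u) = B := by
      rw [hB, hY, Finset.mul_sum, Finset.mul_sum]
    have hX0 : 0 ≤ X := Finset.sum_nonneg hn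
    have f1 : X * (1 - η) ≤ B := by
      rw [← hsumB, hX, Finset.sum_mul]
      exact Finset.sum_le_sum fun u hu =>
        (mul_le_mul_of_nonneg_left (hyη u hu) (hn u hu)).trans (h u hu)
    have f2 : (k - 1) * (N * (1 - η)) ≤ B := by
      rw [← hsumB, ← hI, ← nsmul_eq_mul, ← Finset.sum_const]
      exact Finset.sum_le_sum fun u hu =>
        (mul_le_mul_of_nonneg_left (hyη u hu) hN).trans (hN' u hu)
    have f3 : ∑ u ∈ I, n u * (1 + η - y u) ≤ B + η * X := by
      rw [← hsumB, hX, Finset.mul_sum, ← Finset.sum_add_distrib]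
      refine Finset.sum_le_sum fun u hu => ?_
      have := h u hu
      linarith
    -- By `f1` and `f2`, `X + N ≤ k / ((k - 1) * (1 - η)) * B`; `hη2` is what makes `η` times this
    -- at most `B`.
    have f4 : (k - 1) * (1 - η) * (η * (X + N)) ≤ (k - 1) * (1 - η) * B := by
      have g1 : (k - 1) * η * (X * (1 - η)) ≤ (k - 1) * η * B :=
        mul_le_mul_of_nonneg_left f1 (mul_nonneg (by linarith) hη.le)
      have g2 : η * ((k - 1) * (N * (1 - η))) ≤ η * B := mul_le_mul_of_nonneg_left f2 hη.le
      have g3 : k * η * B ≤ (k - 1) * (1 - η) * B := mul_le_mul_of_nonneg_right hη2 hB0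
      linarith
    have f5 : η * (X + N) ≤ B :=
      le_of_mul_le_mul_left f4 (mul_pos (by linarith) (by linarith))
    have f6 : N * (η - Y) ≤ N * η := mul_le_mul_of_nonneg_left (by linarith) hN
    have f7 : L * (Y - (k - 1) * (z + Y)) = - 2 * B - L * ((k - 1) * z) := by rw [hB]; ring
    linarith

/-! ### SIA with `d ≥ 2`: stars and pairs of constant sum -/

section StarPrices

variable {k L : ℕ}

open Classical in
/-- The ratio of losing to winning probabilities of the pair `j` of points, for a random point. -/
noncomputable def pairOdds (j : Sym2 (ZMod k)) : ℝ :=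
  if j.IsDiag then (k : ℝ) - 1 else ((k : ℝ) - 2) / 2

theorem pairOdds_diag (v : ZMod k) : pairOdds s(v, v) = (k : ℝ) - 1 := by simp [pairOdds]

theorem pairOdds_of_ne {u v : ZMod k} (h : u ≠ v) : pairOdds s(u, v) = ((k : ℝ) - 2) / 2 := by
  simp [pairOdds, h]

theorem pairOdds_pos (hk : 3 ≤ k) (j : Sym2 (ZMod k)) : 0 < pairOdds j := by
  have : (3 : ℝ) ≤ k := by exact_mod_cast hk
  unfold pairOdds
  split_ifs <;> linarith

/-- The `l`-th price level of the pair `j`. -/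
noncomputable def pairLevel (j : Sym2 (ZMod k)) (l : Fin L) : ℝ :=
  (((l : ℕ) + 1) / L : ℝ) / (pairOdds j + ((l : ℕ) + 1) / L)

theorem pairLevel_pos (hk : 3 ≤ k) (j : Sym2 (ZMod k)) (l : Fin L) : 0 < pairLevel j l := by
  have hL : (0 : ℝ) < L := by exact_mod_cast l.pos
  have := pairOdds_pos hk j
  unfold pairLevel
  positivity

/-- A pair of given sum is determined by either of its points, so a row meets each star in a single
item. -/
theorem mem_pair_sub {c i v : ZMod k} (h : v ∈ s(i, c - i)) : s(i, c - i) = s(v, c - v) := by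
  rcases Sym2.mem_iff.1 h with rfl | rfl
  · rfl
  · rw [sub_sub_cancel]; exact Sym2.eq_swap

variable [NeZero k]

/-- The items are the pairs of points in `ZMod k`, including the diagonal ones; all pairs that
contain a random point have positive prices, of a random level. -/
noncomputable def starPrices (hk : 3 ≤ k) (L : ℕ) :
    PriceScheme (ZMod k × Fin L) (Sym2 (ZMod k)) (ZMod k) where
  p ω j := if ω.1 ∈ j then (pairLevel j ω.2).toNNReal else 0
  T v := Finset.univ.image fun u => s(u, v)
  act ω v := ω.1 = v
  exists_act ω j h := by
    refine ⟨ω.1, rfl, ?_⟩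
    have hj : ω.1 ∈ j := by
      by_contra hj
      simp [hj] at h
    obtain ⟨u, rfl⟩ := hj
    exact Finset.mem_image.2 ⟨u, Finset.mem_univ _, Sym2.eq_swap⟩
  act_unique ω b b' j h h' _ _ := h.symm.trans h'
  pos_of_act ω b j h hj := by
    obtain ⟨u, -, rfl⟩ := Finset.mem_image.1 hj
    rw [if_pos (by simp [h])]
    simpa using pairLevel_pos hk _ _
  exists_pos ω b := by
    refine ⟨s(ω.1, b), Finset.mem_image.2 ⟨ω.1, Finset.mem_univ _, rfl⟩, ?_⟩
    rw [if_pos (by simp)]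
    simpa using pairLevel_pos hk _ _

/-- The pairs with a given sum. -/
def pairsWithSum (c : ZMod k) : Finset (Sym2 (ZMod k)) :=
  Finset.univ.image fun i => s(i, c - i)

theorem disjoint_pairsWithSum {c c' : ZMod k} (h : c ≠ c') :
    Disjoint (pairsWithSum c) (pairsWithSum c') := by
  rw [Finset.disjoint_left]
  intro j hj hj'
  obtain ⟨i, -, rfl⟩ := Finset.mem_image.1 hj
  obtain ⟨i', -, he⟩ := Finset.mem_image.1 hj'
  rw [Sym2.eq_iff] at he
  refine h ?_
  rcases he with ⟨h1, h2⟩ | ⟨h1, h2⟩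
  · rw [h1] at h2; exact (sub_left_inj.1 h2).symm
  · rw [h1] at h2; linear_combination -h2

/-- Each pair is counted as often as it has points. -/
theorem sum_pairOdds_mul (c : ZMod k) (y : Sym2 (ZMod k) → ℝ) :
    ∑ v, (pairOdds s(v, c - v) + 1) * y s(v, c - v) = k * ∑ j ∈ pairsWithSum c, y j := by
  rw [Finset.sum_comp (fun j => (pairOdds j + 1) * y j) fun v => s(v, c - v), Finset.mul_sum]
  refine Finset.sum_congr rfl fun j hj => ?_
  obtain ⟨i, -, rfl⟩ := Finset.mem_image.1 hj
  have hfib : (Finset.univ.filter fun v => s(v, c - v) = s(i, c - i)) = {i, c - i} := by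
    ext v
    simp only [Finset.mem_filter, Finset.mem_univ, true_and, Finset.mem_insert,
      Finset.mem_singleton]
    constructor
    · intro h
      have : v ∈ s(i, c - i) := by rw [← h]; simp
      exact Sym2.mem_iff.1 this
    · intro h
      exact (mem_pair_sub (Sym2.mem_iff.2 h)).symm
  rw [hfib, nsmul_eq_mul, ← mul_assoc]
  congr 1
  by_cases h : i = c - i
  · rw [← h, pairOdds_diag]; simp
  · rw [pairOdds_of_ne h, Finset.card_pair h]; push_cast; ring

variable {hk : 3 ≤ k}

theorem starPrices_of_mem {ω : ZMod k × Fin L} {j : Sym2 (ZMod k)} (h : ω.1 ∈ j) :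
    ((starPrices hk L).p ω j : ℝ) = pairLevel j ω.2 := by
  simp only [starPrices, if_pos h]
  exact Real.coe_toNNReal _ (pairLevel_pos hk _ _).le

theorem starPrices_of_notMem {ω : ZMod k × Fin L} {j : Sym2 (ZMod k)} (h : ω.1 ∉ j) :
    (starPrices hk L).p ω j = 0 := if_neg h

theorem card_levels_mul_le {v : ZMod k} {j : Sym2 (ZMod k)} (hv : v ∈ j) {y : ℝ≥0}
    {S : Finset (Fin L)} (hS : ∀ l ∈ S, (starPrices hk L).p (v, l) j ≤ y) :
    (S.card : ℝ) * (1 - y) ≤ L * (pairOdds j * y) := by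
  refine card_mul_one_sub_le (pairOdds_pos hk j).le y.2 fun l hl => ?_
  have h1 : ((starPrices hk L).p (v, l) j : ℝ) ≤ y := by exact_mod_cast hS l hl
  rwa [starPrices_of_mem hv] at h1

/-- In the states of point `v` only `s(v, c - v)` is priced within the row. The price levels bound
their contribution by `L * ((pairOdds + 1) * y - S)`. As `pairOdds + 1` is `k` divided by the number
of points of the pair, these bounds sum to zero over `v`. -/
theorem noGain_pairsWithSum (c : ZMod k) :
    NoGain (starPrices hk L).p (pairsWithSum c) 1 := by
  classical
  intro y W hlt hle
  set S := ∑ j ∈ pairsWithSum c, (y j : ℝ) with hS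
  rw [Fintype.sum_prod_type]
  have hmem : ∀ v, s(v, c - v) ∈ pairsWithSum c := fun v =>
    Finset.mem_image.2 ⟨v, Finset.mem_univ _, rfl⟩
  have hv : ∀ v, ∑ l : Fin L, ((if pairsWithSum c ⊆ W (v, l) then (1 : ℝ) else 0)
      - ∑ j ∈ pairsWithSum c ∩ W (v, l), (y j : ℝ))
      ≤ L * ((pairOdds s(v, c - v) + 1) * y s(v, c - v) - S) := by
    intro v
    refine (Finset.sum_le_sum fun l _ => utility_le_of_unique_price (p := (starPrices hk L).p (v, l))
      zero_le_one (hmem v) ?_ (hlt (v, l))).trans ?_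
    · intro j hj hne
      refine starPrices_of_notMem fun hv => hne ?_
      obtain ⟨i, -, rfl⟩ := Finset.mem_image.1 hj
      exact mem_pair_sub hv
    · rw [Finset.sum_add_distrib, ← Finset.sum_filter, Finset.sum_const, Finset.sum_const,
        nsmul_eq_mul, nsmul_eq_mul, Finset.card_univ, Fintype.card_fin, ← hS]
      have := card_levels_mul_le (hk := hk) (v := v) (j := s(v, c - v)) (by simp)
        (y := y s(v, c - v))
        (S := Finset.univ.filter fun l => s(v, c - v) ∈ W (v, l))
        (fun l hl => hle _ _ (Finset.mem_filter.1 hl).2)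
      linarith
  refine (Finset.sum_le_sum fun v _ => hv v).trans ?_
  rw [← Finset.mul_sum, Finset.sum_sub_distrib, sum_pairOdds_mul c fun j => (y j : ℝ)]
  simp [ZMod.card, hS]

theorem sum_star (v : ZMod k) (y : Sym2 (ZMod k) → ℝ) :
    ∑ j ∈ (starPrices hk L).T v, y j
      = y s(v, v) + ∑ u ∈ Finset.univ.erase v, y s(u, v) := by
  rw [Finset.add_sum_erase _ (fun u => y s(u, v)) (Finset.mem_univ v)]
  exact Finset.sum_image fun u _ u' _ h => Sym2.congr_left.1 h

/-- A point `u ≠ v` prices only `s(u, v)` within the star, while `v` prices all of it. Counting the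
levels won in each case (`n u` and `N`) reduces the claim to `sum_utility_le_zero`. -/
theorem noGain_star {η : ℝ} (hη : 0 < η) (hη1 : k * η ≤ k - 2)
    (hη2 : k * η ≤ (k - 1) * (1 - η)) (hη3 : η < 1) (v : ZMod k) :
    NoGain (starPrices hk L).p ((starPrices hk L).T v) (1 + η) := by
  classical
  intro y W hlt hle
  have hk' : (3 : ℝ) ≤ k := by exact_mod_cast hk
  have hmem : ∀ u, s(u, v) ∈ (starPrices hk L).T v := fun u =>
    Finset.mem_image.2 ⟨u, Finset.mem_univ _, rfl⟩
  set S := ∑ j ∈ (starPrices hk L).T v, (y j : ℝ) with hS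
  rw [Fintype.sum_prod_type, ← Finset.add_sum_erase _ _ (Finset.mem_univ v), add_comm]
  set n : ZMod k → ℝ := fun u => ((Finset.univ.filter fun l => s(u, v) ∈ W (u, l)).card : ℝ)
  set N : ℝ := ((Finset.univ.filter fun l => (starPrices hk L).T v ⊆ W (v, l)).card : ℝ)
  have hother : ∀ u ∈ Finset.univ.erase v,
      ∑ l : Fin L, ((if (starPrices hk L).T v ⊆ W (u, l) then (1 + η) else 0)
        - ∑ j ∈ (starPrices hk L).T v ∩ W (u, l), (y j : ℝ))
      ≤ n u * (1 + η - y s(u, v)) + L * (y s(u, v) - S) := by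
    intro u hu
    refine (Finset.sum_le_sum fun l _ => utility_le_of_unique_price (p := (starPrices hk L).p (u, l))
      (by positivity) (hmem u) ?_ (hlt (u, l))).trans ?_
    · intro j hj hne
      refine starPrices_of_notMem fun hu' => hne ?_
      obtain ⟨i, -, rfl⟩ := Finset.mem_image.1 hj
      rcases Sym2.mem_iff.1 hu' with h | h
      · exact congrArg (fun i => s(i, v)) h.symm
      · exact absurd h (Finset.ne_of_mem_erase hu)
    · rw [Finset.sum_add_distrib, ← Finset.sum_filter, Finset.sum_const, Finset.sum_const,
        nsmul_eq_mul, nsmul_eq_mul, Finset.card_univ, Fintype.card_fin, ← hS]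
  have hown : ∑ l : Fin L, ((if (starPrices hk L).T v ⊆ W (v, l) then (1 + η) else 0)
        - ∑ j ∈ (starPrices hk L).T v ∩ W (v, l), (y j : ℝ)) ≤ N * (1 + η - S) := by
    have : ∀ l : Fin L, (if (starPrices hk L).T v ⊆ W (v, l) then (1 + η) else 0)
        - ∑ j ∈ (starPrices hk L).T v ∩ W (v, l), (y j : ℝ)
        ≤ if (starPrices hk L).T v ⊆ W (v, l) then 1 + η - S else 0 := by
      intro l
      split_ifs with h
      · rw [Finset.inter_eq_left.2 h]
      · have : 0 ≤ ∑ j ∈ (starPrices hk L).T v ∩ W (v, l), (y j : ℝ) :=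
          Finset.sum_nonneg fun _ _ => NNReal.coe_nonneg _
        linarith
    refine (Finset.sum_le_sum fun l _ => this l).trans (le_of_eq ?_)
    rw [← Finset.sum_filter, Finset.sum_const, nsmul_eq_mul]
  refine (add_le_add (Finset.sum_le_sum hother) hown).trans ?_
  have hSe : S = y s(v, v) + ∑ u ∈ Finset.univ.erase v, (y s(u, v) : ℝ) :=
    sum_star v fun j => (y j : ℝ)
  have hNS : ∀ u, ∀ l ∈ Finset.univ.filter fun l => (starPrices hk L).T v ⊆ W (v, l),
      (starPrices hk L).p (v, l) s(u, v) ≤ y s(u, v) := fun u l hl =>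
    hle _ _ ((Finset.mem_filter.1 hl).2 (hmem u))
  rw [hSe]
  refine sum_utility_le_zero (Finset.univ.erase v) hk' ?_ hη hη1 hη2 hη3 ?_ ?_ ?_ ?_ ?_ ?_ ?_ ?_
  · rw [Finset.card_erase_of_mem (Finset.mem_univ v), Finset.card_univ, ZMod.card,
      Nat.cast_sub (by omega), Nat.cast_one]
  · intro u _
    have := Finset.card_le_univ (Finset.univ.filter fun l : Fin L => s(u, v) ∈ W (u, l))
    rw [Fintype.card_fin] at this
    exact Nat.cast_le.2 this
  · exact fun u _ => Nat.cast_nonneg _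
  · exact Nat.cast_nonneg _
  · exact fun u _ => NNReal.coe_nonneg _
  · exact Nat.cast_nonneg _
  · intro u hu
    rw [← pairOdds_of_ne (Finset.ne_of_mem_erase hu)]
    exact card_levels_mul_le (hk := hk) (v := u) (by simp)
      fun l hl => hle _ _ (Finset.mem_filter.1 hl).2
  · intro u hu
    rw [← pairOdds_of_ne (Finset.ne_of_mem_erase hu)]
    exact card_levels_mul_le (hk := hk) (v := v) (by simp) (hNS u)
  · rw [← pairOdds_diag v]
    exact card_levels_mul_le (hk := hk) (v := v) (by simp) (hNS v)

/-- Each price lies below its tangent at `t = 1 / 2`, where the off-diagonal prices sum to 1 and the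
diagonal one is `1 / (2 * k - 1)`. The grid `(l + 1) / L` has total excess `1 / 2` over the
midpoint, which costs `C / 2 ≤ 1`. -/
theorem sum_star_prices_le (hL : 0 < L) (v : ZMod k) :
    ∑ l : Fin L, ∑ j ∈ (starPrices hk L).T v, ((starPrices hk L).p (v, l) j : ℝ)
      ≤ L * (1 + 1 / (2 * k - 1)) + 1 := by
  have hk' : (3 : ℝ) ≤ k := by exact_mod_cast hk
  have hL' : (0 : ℝ) < L := by exact_mod_cast hL
  set C : ℝ := (k - 1) * (((k : ℝ) - 2) / 2 / ((k - 2) / 2 + 1 / 2) ^ 2)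
    + (k - 1) / (k - 1 + 1 / 2) ^ 2 with hC
  have hl : ∀ l : Fin L, ∑ j ∈ (starPrices hk L).T v, ((starPrices hk L).p (v, l) j : ℝ)
      ≤ (1 + 1 / (2 * k - 1)) + C * ((((l : ℕ) + 1) / L : ℝ) - 1 / 2) := by
    intro l
    set t := (((l : ℕ) + 1) / L : ℝ) with ht
    have ht0 : 0 < t := by positivity
    rw [sum_star v fun j => ((starPrices hk L).p (v, l) j : ℝ)]
    have h1 : ((starPrices hk L).p (v, l) s(v, v) : ℝ) ≤ 1 / 2 / (k - 1 + 1 / 2)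
        + (k - 1) / (k - 1 + 1 / 2) ^ 2 * (t - 1 / 2) := by
      rw [starPrices_of_mem (by simp), pairLevel, pairOdds_diag]
      exact div_add_self_le_tangent (by linarith) (by norm_num) ht0
    have h2 : ∀ u ∈ Finset.univ.erase v, ((starPrices hk L).p (v, l) s(u, v) : ℝ)
        ≤ 1 / 2 / (((k : ℝ) - 2) / 2 + 1 / 2)
        + ((k : ℝ) - 2) / 2 / ((k - 2) / 2 + 1 / 2) ^ 2 * (t - 1 / 2) := by
      intro u hu
      rw [starPrices_of_mem (by simp), pairLevel, pairOdds_of_ne (Finset.ne_of_mem_erase hu)]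
      exact div_add_self_le_tangent (by linarith) (by norm_num) ht0
    have h3 := Finset.sum_le_card_nsmul _ _ _ h2
    rw [nsmul_eq_mul, Finset.card_erase_of_mem (Finset.mem_univ v), Finset.card_univ, ZMod.card,
      Nat.cast_sub (by omega), Nat.cast_one] at h3
    have e1 : (1 : ℝ) / 2 / (k - 1 + 1 / 2) = 1 / (2 * k - 1) := by
      have h0 : (2 * (k : ℝ) - 1) ≠ 0 := by linarith
      have : (k : ℝ) - 1 + 1 / 2 = (2 * k - 1) / 2 := by ring
      rw [this]
      field_simp
    have e2 : ((k : ℝ) - 1) * (1 / 2 / (((k : ℝ) - 2) / 2 + 1 / 2)) = 1 := by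
      have h0 : (k : ℝ) - 1 ≠ 0 := by linarith
      have : ((k : ℝ) - 2) / 2 + 1 / 2 = (k - 1) / 2 := by ring
      rw [this]
      field_simp
    rw [e1] at h1
    rw [mul_add, e2] at h3
    rw [hC]
    linarith
  refine (Finset.sum_le_sum fun l _ => hl l).trans ?_
  rw [Finset.sum_add_distrib, ← Finset.mul_sum, sum_fin_add_one_div_sub_half hL, Finset.sum_const,
    nsmul_eq_mul, Finset.card_univ, Fintype.card_fin]
  have hC2 : C ≤ 2 := by
    have e1 : ((k : ℝ) - 1) * (((k : ℝ) - 2) / 2 / ((k - 2) / 2 + 1 / 2) ^ 2)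
        = 2 - 2 / (k - 1) := by
      have h0 : (k : ℝ) - 1 ≠ 0 := by linarith
      have : ((k : ℝ) - 2) / 2 + 1 / 2 = (k - 1) / 2 := by ring
      rw [this]
      field_simp; ring
    have e2 : ((k : ℝ) - 1) / (k - 1 + 1 / 2) ^ 2 ≤ 2 / (k - 1) := by
      rw [div_le_div_iff₀ (by nlinarith) (by linarith)]
      nlinarith
    rw [hC, e1]
    linarith
  linarith

/-- The price of anarchy bound for `d = k - 1 ≥ 2`. -/
theorem exists_priceOfAnarchy_of_three_le (hk : 3 ≤ k) :
    ∃ (n m : ℕ) (v : Valuations n m), k - 1 < m ∧ (∀ i, InSAW (k - 1) (v i)) ∧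
      ∀ π : Equiv.Perm (Fin n), ENNReal.ofReal ((k : ℝ) - 1 + 1 / k) ≤
        priceOfAnarchy (simultaneousItemAuction m π) v
          (coarseCorrelated (simultaneousItemAuction m π) v) := by
  classical
  have hk' : (3 : ℝ) ≤ k := by exact_mod_cast hk
  set D : ℝ := (k : ℝ) ^ 2 - k + 1 with hD
  have hD0 : 0 < D := by rw [hD]; nlinarith
  -- Then `1 + η = k ^ 2 / D`, so `k / (1 + η)` is the desired ratio.
  set η : ℝ := (k - 1) / D with hη
  have hη0 : 0 < η := div_pos (by linarith) hD0
  have hηD : η * D = k - 1 := div_mul_cancel₀ _ hD0.ne'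
  have hη1 : k * η ≤ k - 2 := by
    rw [hη, mul_div_assoc', div_le_iff₀ hD0, hD]
    nlinarith [mul_nonneg (sub_nonneg.2 hk') (sub_nonneg.2 hk'),
      mul_nonneg (mul_nonneg (sub_nonneg.2 hk') (sub_nonneg.2 hk')) (sub_nonneg.2 hk')]
  have hη2 : k * η ≤ (k - 1) * (1 - η) := by
    have : (k - 1) * (1 - η) = (k - 1) * (D - (k - 1)) / D := by rw [hη]; field_simp
    rw [this, hη, mul_div_assoc']
    refine div_le_div_of_nonneg_right ?_ hD0.le
    rw [hD]
    nlinarith [mul_nonneg (sub_nonneg.2 hk') (sub_nonneg.2 hk'),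
      mul_nonneg (mul_nonneg (sub_nonneg.2 hk') (sub_nonneg.2 hk')) (sub_nonneg.2 hk')]
  have hη3 : η < 1 := by rw [hη, div_lt_one hD0, hD]; nlinarith
  -- So fine a grid keeps the average star price within `1 + η`; multiplied by `L`, this becomes `D
  -- + 1 ≤ (2 * k - 1) * (k - 1)`.
  obtain ⟨L, hL⟩ : ∃ L : ℕ, (L : ℝ) = D * (2 * k - 1) := by
    refine ⟨(k * (k - 1) + 1) * (2 * k - 1), ?_⟩
    push_cast [Nat.cast_sub (show 1 ≤ k by omega), Nat.cast_sub (show 1 ≤ 2 * k by omega)]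
    rw [hD]; ring
  have hL0 : 0 < L := by
    have : (0 : ℝ) < L := by rw [hL]; exact mul_pos hD0 (by linarith)
    exact_mod_cast this
  have : Nonempty (ZMod k × Fin L) := ⟨(0, ⟨0, hL0⟩)⟩
  have key := (starPrices hk L).exists_le_priceOfAnarchy (O := pairsWithSum) (w := 1 + η)
    (d := k - 1) (A := 1) (by positivity) ?_ ?_ ?_ ?_ noGain_pairsWithSum
    (noGain_star hη0 hη1 hη2 hη3) (fun _ _ => disjoint_pairsWithSum) ?_ one_pos ?_
  · convert key using 8
    rw [ZMod.card, Nat.cast_one, one_mul, hη]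
    have h0 : D + (k - 1) = k ^ 2 := by rw [hD]; ring
    have h1 : 1 + ((k : ℝ) - 1) / D = k ^ 2 / D := by rw [← h0]; field_simp
    have h2 : (k : ℝ) ≠ 0 := by linarith
    rw [h1, hD]
    field_simp
  · have := Fintype.card_le_of_injective (fun u : ZMod k => s(u, u)) fun u u' h => by
      simpa using h
    rw [ZMod.card] at this
    omega
  · intro b
    refine Finset.card_image_le.trans ?_
    rw [Finset.card_univ, ZMod.card]; omega
  · intro b
    refine Finset.card_image_le.trans ?_
    rw [Finset.card_univ, ZMod.card]; omega
  · intro v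
    rw [Fintype.sum_prod_type, Finset.sum_eq_single v]
    · have hle := sum_star_prices_le (hk := hk) hL0 v
      have : ∀ l : Fin L, (starPrices hk L).act (v, l) v := fun _ => rfl
      simp only [this, if_true]
      rw [Finset.sum_sub_distrib, Finset.sum_const, nsmul_eq_mul, Finset.card_univ,
        Fintype.card_fin]
      have h1 : (L : ℝ) * (1 / (2 * k - 1)) = D := by
        rw [hL]
        have : (2 * (k : ℝ) - 1) ≠ 0 := by linarith
        field_simp
      have h2 : (L : ℝ) * η = (2 * k - 1) * (k - 1) := by rw [hL, ← hηD]; ring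
      have h3 : D + 1 ≤ (2 * k - 1) * (k - 1) := by rw [hD]; nlinarith
      linarith
    · intro u _ hu
      exact Finset.sum_eq_zero fun l _ => if_neg hu
    · intro h; exact absurd (Finset.mem_univ v) h
  · intro ω c
    refine ⟨s(ω.1, c - ω.1), Finset.mem_image.2 ⟨ω.1, Finset.mem_univ _, rfl⟩, ?_⟩
    rw [← NNReal.coe_pos, starPrices_of_mem (by simp)]
    exact pairLevel_pos hk _ _
  · intro ω
    refine Finset.card_le_one.2 fun a ha b hb => ?_
    exact (Finset.mem_filter.1 ha).2.symm.trans (Finset.mem_filter.1 hb).2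

end StarPrices

theorem mainTheorem12 :
    (∀ d : ℕ, 1 ≤ d → ∀ ε : ℝ, 0 < ε →
      ∃ (n m : ℕ) (v : Valuations n m), d < m ∧ (∀ i, InSAW d (v i)) ∧
        ∀ π : Equiv.Perm (Fin n),
          (pureNash (singleBidAuction m π) v).Nonempty ∧
          ENNReal.ofReal ((d : ℝ) + 1 - ε / d) ≤
            priceOfStability (singleBidAuction m π) v (pureNash (singleBidAuction m π) v) ∧
          ENNReal.ofReal ((d : ℝ) + 1 - ε / d) ≤
            priceOfStability (singleBidAuction m π) v (mixedNash (singleBidAuction m π) v) ∧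
          ENNReal.ofReal ((d : ℝ) + 1 - ε / d) ≤
            priceOfStability (singleBidAuction m π) v
              (coarseCorrelated (singleBidAuction m π) v)) ∧
    (∀ d : ℕ, 1 ≤ d →
      ∃ (n m : ℕ) (v : Valuations n m), d < m ∧ (∀ i, InSAW d (v i)) ∧
        ∀ π : Equiv.Perm (Fin n),
          ENNReal.ofReal ((d : ℝ) + 1 / ((d : ℝ) + 1)) ≤
            priceOfAnarchy (simultaneousItemAuction m π) v
              (coarseCorrelated (simultaneousItemAuction m π) v)) := by
  refine ⟨exists_singleBid_priceOfStability, fun d hd => ?_⟩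
  -- For `k = 2` the off-diagonal odds `(k - 2) / 2` vanish and the star prices degenerate, hence
  -- the separate case `d = 1`.
  rcases hd.eq_or_lt with rfl | hd
  · convert exists_priceOfAnarchy_three_halves using 8
    norm_num
  · have h := exists_priceOfAnarchy_of_three_le (k := d + 1) (by omega)
    simpa using h
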